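/- For $k \ge 1$ let $\mathcal M_k$ be the algebra of $k\times k$ complex matrices. For real $p \ge 1$ let $\|M\|_p = (\mathrm{Tr}\,|M|^p)^{1/p}$ be the Schatten norm, where $|M| = (M^*M)^{1/2}$, and for a linear map $L : \mathcal M_k \to \mathcal M_k$ and real $p, q \ge 1$ let $$\|L\|_{p\to q} = \sup_{M \in \mathcal M_k,\ M \ne 0} \frac{\|L(M)\|_q}{\|M\|_p}.$$ The map $L$ is completely positive if $\mathcal I_m \otimes L$ sends positive semidefinite matrices in $\mathcal M_m \otimes \mathcal M_k = \mathcal M_{mk}$ to positive semidefinite matrices for every $m \ge 1$, where $\mathcal I_m$ is the identity map of $\mathcal M_m$. A unital qubit channel is a completely positive, trace-preserving linear map $\Phi : \mathcal M_2 \to \mathcal M_2$ with $\Phi(I_2) = I_2$. Theorem. Let $\Phi$ be a unital qubit channel, and let $\Omega : \mathcal M_k \to \mathcal M_k$ be a completely positive linear map, $k \ge 1$. Then for all real $p, q$ with $1 \le p \le 2 \le q$, $$\|\Omega \otimes \Phi\|_{p\to q} = \|\Omega\|_{p\to q}\,\|\Phi\|_{p\to q},$$ where $\Omega \otimes \Phi$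 acts on $\mathcal M_k \otimes \mathcal M_2 = \mathcal M_{2k}$. -/

import Mathlib

open scoped ENNReal MatrixOrder ComplexOrder Kronecker

noncomputable section

namespace QubitMult

/-- The algebra `𝓜 ι` of square complex matrices with rows and columns indexed by `ι`. -/
abbrev Mat (ι : Type*) : Type _ := Matrix ι ι ℂ

/-- Linear maps on a matrix algebra (superoperators). -/
abbrev SuperOp (ι : Type*) : Type _ := Mat ι →ₗ[ℂ] Mat ι

section

variable {ι κ : Type*} [Fintype ι] [DecidableEq ι] [Fintype κ] [DecidableEq κ]

/-- The Schatten norm `‖M‖_p = (Tr |M|^p)^{1/p}`, where `|M| = (M* M)^{1/2}`. The matrix powers are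
those of the continuous functional calculus. -/
def schattenNorm (p : ℝ) (M : Mat ι) : ℝ :=
  (Matrix.trace (CFC.abs M ^ p)).re ^ (1 / p)

/-- The norm `‖L‖_{p → q} = sup_{M ≠ 0} ‖L M‖_q / ‖M‖_p`. The supremum is taken in `[0, ∞]`, so
that no boundedness needs to be checked for it to have its usual meaning. -/
def mapNorm (p q : ℝ) (L : SuperOp ι) : ℝ≥0∞ :=
  ⨆ (M : Mat ι) (_ : M ≠ 0), ENNReal.ofReal (schattenNorm q (L M) / schattenNorm p M)

/-- The tensor product `L ⊗ K` of two maps, acting on `𝓜 (ι × κ) = 𝓜 ι ⊗ 𝓜 κ`; the identification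
is given by the Kronecker product. -/
def tensorMap (L : SuperOp ι) (K : SuperOp κ) : SuperOp (ι × κ) :=
  (kroneckerLinearEquiv ι ι κ κ ℂ).toLinearMap ∘ₗ
    TensorProduct.map L K ∘ₗ (kroneckerLinearEquiv ι ι κ κ ℂ).symm.toLinearMap

theorem tensorMap_kronecker (L : SuperOp ι) (K : SuperOp κ) (A : Mat ι) (B : Mat κ) :
    tensorMap L K (A ⊗ₖ B) = L A ⊗ₖ K B := by
  simp [tensorMap]

/-- A map preserves positivity if it sends positive semidefinite matrices to positive semidefinite
matrices. -/
def IsPositivityPreserving (L : SuperOp ι) : Prop :=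
  ∀ A : Mat ι, A.PosSemidef → (L A).PosSemidef

/-- `L` is completely positive if `I_m ⊗ L` preserves positivity on `𝓜_m ⊗ 𝓜 ι` for all `m`. -/
def IsCompletelyPositive (L : SuperOp ι) : Prop :=
  ∀ m : ℕ, IsPositivityPreserving (tensorMap (LinearMap.id : SuperOp (Fin m)) L)

/-- A quantum channel: a completely positive and trace-preserving map. -/
structure IsQuantumChannel (L : SuperOp ι) : Prop where
  completelyPositive : IsCompletelyPositive L
  trace_map : ∀ A : Mat ι, (L A).trace = A.trace

end

/-- A unital qubit channel: a quantum channel on `𝓜₂` that fixes the identity matrix. -/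
structure IsUnitalQubitChannel (Φ : SuperOp (Fin 2)) : Prop where
  isQuantumChannel : IsQuantumChannel Φ
  map_one : Φ 1 = 1

end QubitMult

end

/-! The norm of Ω ⊗ Φ is at least the product because Schatten norms multiply on Kronecker products.
For the upper bound, every matrix is the off-diagonal block of a positive matrix whose diagonal
blocks have the same norms, and the norm of an off-diagonal block of a positive matrix is at most
the geometric mean of those of the diagonal blocks. Two-positivity therefore reduces the bound to
positive M.

A single pair of singular vectors of the real 3 × 3 Bloch matrix of Φ gives unitaries that turn Φ
into a map Ψ treating diagonal and off-diagonal entries separately (`exists_rotated_form`). View M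
as a 2 × 2 block matrix with blocks X, Y, Yᴴ, Z. The key is King's inequality: replacing the blocks
of a positive block matrix by their Schatten norms does not increase the Schatten norm for 1 ≤ p ≤ 2
(`eigMax_rpow_add_eigMin_rpow_le`), and does not decrease it for q ≥ 2 (`schattenNorm_le_herm2`, by
duality). Hence the output is bounded by the 2 × 2 matrix of its block norms. By the triangle
inequality that matrix is dominated entrywise in modulus by Ψ applied to the matrix of the q-norms
of Ω X, Ω Y, Ω Z, up to a phase. Now the norm of Φ applies to this 2 × 2 matrix, the norm of Ω to
each entry, and King's inequality at p returns to M (`schattenNorm_tensorMap_le_of_posSemidef`).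

King's inequality for 1 < p < 2 rests on t ^ p being a positive multiple of the integral of u ^ (-p
- 1) (t u - log (1 + t u)) over u > 0: for signed families with vanishing sum, comparing p-th power
sums reduces to comparing log-determinants (`sum_mul_rpow_nonneg`). A singular value decomposition
makes Y diagonal, a Hadamard–Fischer inequality (`det_fromBlocks_mul_prod_le`) compares the block
matrix with a family of scalar 2 × 2 matrices, and convexity of -log (1 - exp (-t)) merges the
family into the single matrix of norms (`traceExcess_le_sum`). -/

noncomputable section

namespace QubitMult

open Matrix

/-! ### Singular value decomposition, over the reals and the complex numbers -/

section SVD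

variable {𝕜 n : Type*} [RCLike 𝕜] [Fintype n] [DecidableEq n]

/-- Columns with diagonal Gram matrix are multiples of the columns of a unitary matrix. -/
theorem exists_unitary_mul_diagonal (W : Matrix n n 𝕜) (d : n → ℝ)
    (h : Wᴴ * W = diagonal (fun i => ((d i ^ 2 : ℝ) : 𝕜))) :
    ∃ U ∈ unitaryGroup n 𝕜, W = U * diagonal (fun i => (d i : 𝕜)) := by
  have hW (i j : n) : ∑ k, star (W k i) * W k j = if i = j then ((d i ^ 2 : ℝ) : 𝕜) else 0 := by
    have := congrFun (congrFun h i) j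
    simpa [Matrix.mul_apply, diagonal_apply] using this
  let v : n → EuclideanSpace 𝕜 n := fun j => WithLp.toLp 2 fun i => ((d j)⁻¹ : 𝕜) * W i j
  have hv : Orthonormal 𝕜 (Set.domRestrict {j | d j ≠ 0} v) := by
    rw [orthonormal_iff_ite]
    rintro ⟨i, hi⟩ ⟨j, hj⟩
    have hi' : (d i : 𝕜) ≠ 0 := by simpa using hi
    have : inner 𝕜 (v i) (v j) = ((d i)⁻¹ : 𝕜) * (d j)⁻¹ * ∑ k, star (W k i) * W k j := by
      simp only [v, PiLp.inner_apply, RCLike.inner_apply, Finset.mul_sum]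
      refine Finset.sum_congr rfl fun k _ => ?_
      simp only [map_mul, map_inv₀, RCLike.conj_ofReal, RCLike.star_def]
      ring
    simp only [Set.domRestrict_apply, this, hW, Subtype.mk.injEq]
    split_ifs with hij
    · subst hij
      push_cast
      field_simp
    · simp
  -- The basis vectors at indices with `d j = 0` are arbitrary; this is harmless because the
  -- corresponding columns of `W` vanish.
  obtain ⟨b, hb⟩ := hv.exists_orthonormalBasis_extension_of_card_eq (by simp)
  refine ⟨(EuclideanSpace.basisFun n 𝕜).toBasis.toMatrix b.toBasis,
    (EuclideanSpace.basisFun n 𝕜).toMatrix_orthonormalBasis_mem_unitary b, ?_⟩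
  ext i j
  rw [mul_diagonal]
  have hij : (EuclideanSpace.basisFun n 𝕜).toBasis.toMatrix b.toBasis i j = b j i := rfl
  rw [hij]
  by_cases hj : d j = 0
  · have h0 := hW j j
    rw [if_pos rfl, hj] at h0
    have h1 : ∑ k, ‖W k j‖ ^ 2 = 0 := by
      have : ((∑ k, ‖W k j‖ ^ 2 : ℝ) : 𝕜) = 0 := by
        rw [← show ∑ k, star (W k j) * W k j = 0 by simpa using h0]
        push_cast
        exact Finset.sum_congr rfl fun k _ => by rw [RCLike.star_def, RCLike.conj_mul]
      exact_mod_cast this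
    have h2 := (Finset.sum_eq_zero_iff_of_nonneg (fun k _ => by positivity)).1 h1 i
      (Finset.mem_univ i)
    have h3 : W i j = 0 := by simpa using h2
    simp [hj, h3]
  · have hj' : (d j : 𝕜) ≠ 0 := by simpa using hj
    rw [hb j hj]
    simp only [v]
    field_simp

/-- Spectral theorem in matrix form. -/
theorem _root_.Matrix.IsHermitian.exists_unitary_diagonal {A : Matrix n n 𝕜} (hA : A.IsHermitian) :
    ∃ U ∈ unitaryGroup n 𝕜, A = U * diagonal (fun i => (hA.eigenvalues i : 𝕜)) * star U := by
  refine ⟨hA.eigenvectorUnitary, hA.eigenvectorUnitary.2, ?_⟩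
  conv_lhs => rw [hA.spectral_theorem]
  rw [Unitary.conjStarAlgAut_apply]
  rfl

/-- Singular value decomposition of a square matrix. -/
theorem exists_svd (A : Matrix n n 𝕜) :
    ∃ U ∈ unitaryGroup n 𝕜, ∃ V ∈ unitaryGroup n 𝕜, ∃ d : n → ℝ, (∀ i, 0 ≤ d i) ∧
      A = U * diagonal (fun i => (d i : 𝕜)) * star V := by
  have hH := isHermitian_conjTranspose_mul_self A
  obtain ⟨V, hV, h⟩ := hH.exists_unitary_diagonal
  have hl (i : n) : 0 ≤ hH.eigenvalues i := eigenvalues_conjTranspose_mul_self_nonneg A i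
  have hV1 : star V * V = 1 := (mem_unitaryGroup_iff').1 hV
  have hV2 : V * star V = 1 := (mem_unitaryGroup_iff).1 hV
  obtain ⟨U, hU, hW⟩ := exists_unitary_mul_diagonal (A * V) (fun i => √(hH.eigenvalues i)) (by
    simp only [Real.sq_sqrt (hl _)]
    calc (A * V)ᴴ * (A * V) = star V * (Aᴴ * A) * V := by
          rw [conjTranspose_mul]; simp only [star_eq_conjTranspose, Matrix.mul_assoc]
      _ = star V * (V * diagonal (fun i => (hH.eigenvalues i : 𝕜)) * star V) * V :=
          congrArg (fun B => star V * B * V) h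
      _ = (star V * V) * diagonal (fun i => (hH.eigenvalues i : 𝕜)) * (star V * V) := by
          simp only [Matrix.mul_assoc]
      _ = _ := by rw [hV1]; simp)
  refine ⟨U, hU, V, hV, fun i => √(hH.eigenvalues i), fun i => Real.sqrt_nonneg _, ?_⟩
  rw [← hW, Matrix.mul_assoc, hV2, Matrix.mul_one]

/-- Both families are the roots of the characteristic polynomial with multiplicity. Symmetric sums
avoid having to match the orderings. -/
theorem sum_eigenvalues_comp {A : Matrix n n 𝕜} (hA : A.IsHermitian) {V : Matrix n n 𝕜}
    (hV : V ∈ unitaryGroup n 𝕜) {d : n → ℝ}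
    (h : A = V * diagonal (fun i => (d i : 𝕜)) * star V) (f : ℝ → ℝ) :
    ∑ i, f (hA.eigenvalues i) = ∑ i, f (d i) := by
  have h1 : A.charpoly = ∏ i, (Polynomial.X - Polynomial.C (d i : 𝕜)) := by
    rw [h, charpoly_mul_comm, ← Matrix.mul_assoc, (mem_unitaryGroup_iff').1 hV, Matrix.one_mul,
      charpoly_diagonal]
  have h2 := hA.roots_charpoly_eq_eigenvalues
  rw [h1, show (∏ i, (Polynomial.X - Polynomial.C (d i : 𝕜)))
    = (Multiset.map (fun a => Polynomial.X - Polynomial.C a)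
      (Multiset.map (fun i => (d i : 𝕜)) Finset.univ.val)).prod by
        rw [Multiset.map_map]; rfl, Polynomial.roots_multiset_prod_X_sub_C] at h2
  have h3 := congrArg (fun s => (Multiset.map (fun z => f (RCLike.re z)) s).sum) h2
  simp only [Multiset.map_map, Function.comp_def, RCLike.ofReal_re] at h3
  exact h3.symm

end SVD

/-! ### Schatten norms through singular values -/

section Schatten

variable {n : Type*} [Fintype n] [DecidableEq n]

theorem exists_svd_complex (A : Mat n) :
    ∃ U ∈ unitaryGroup n ℂ, ∃ V ∈ unitaryGroup n ℂ, ∃ d : n → ℝ, (∀ i, 0 ≤ d i) ∧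
      A = U * diagonal (fun i => (d i : ℂ)) * star V :=
  exists_svd A

theorem _root_.Matrix.IsHermitian.exists_unitary_diagonal_complex {A : Mat n}
    (hA : A.IsHermitian) :
    ∃ U ∈ unitaryGroup n ℂ, A = U * diagonal (fun i => (hA.eigenvalues i : ℂ)) * star U :=
  hA.exists_unitary_diagonal

theorem star_diagonal_ofReal {n : Type*} [DecidableEq n] (d : n → ℝ) :
    star (diagonal (fun i => (d i : ℂ))) = diagonal (fun i => (d i : ℂ)) := by
  rw [star_eq_conjTranspose, diagonal_conjTranspose]; congr 1; ext i; simp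

theorem trace_unitary_conj {U : Mat n} (hU : U ∈ unitaryGroup n ℂ) (A : Mat n) :
    (U * A * star U).trace = A.trace := by
  rw [trace_mul_cycle, (mem_unitaryGroup_iff').1 hU, Matrix.one_mul]

theorem posSemidef_unitary_diagonal (U : Mat n) {d : n → ℝ} (hd : ∀ i, 0 ≤ d i) :
    (U * diagonal (fun i => (d i : ℂ)) * star U).PosSemidef :=
  (PosSemidef.diagonal (d := fun i => (d i : ℂ))
    (fun i => by simpa using hd i)).mul_mul_conjTranspose_same U

/-- Uniqueness of the positive square root identifies |M| with V D V*. This formula replaces the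
functional calculus in all later arguments. -/
theorem schattenNorm_svd (p : ℝ) {M U V : Mat n} (hU : U ∈ unitaryGroup n ℂ)
    (hV : V ∈ unitaryGroup n ℂ) {d : n → ℝ} (hd : ∀ i, 0 ≤ d i)
    (h : M = U * diagonal (fun i => (d i : ℂ)) * star V) :
    schattenNorm p M = (∑ i, d i ^ p) ^ (1 / p) := by
  have hV1 : star V * V = 1 := (mem_unitaryGroup_iff').1 hV
  have hU1 : star U * U = 1 := (mem_unitaryGroup_iff').1 hU
  have hpos := posSemidef_unitary_diagonal V hd
  have habs : CFC.abs M = V * diagonal (fun i => (d i : ℂ)) * star V := by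
    refine CFC.sqrt_unique ?_ hpos.nonneg
    calc _ = V * (diagonal (fun i => (d i : ℂ)) * ((star V * V) *
          (diagonal (fun i => (d i : ℂ)) * star V))) := by simp only [Matrix.mul_assoc]
      _ = V * (diagonal (fun i => (d i : ℂ)) * ((star U * U) *
          (diagonal (fun i => (d i : ℂ)) * star V))) := by rw [hV1, hU1]
      _ = star M * M := by
          rw [h]; simp only [star_mul, star_star, star_diagonal_ofReal, Matrix.mul_assoc]
  have hH := hpos.1
  have htr : (Matrix.trace (CFC.abs M ^ p)).re = ∑ i, d i ^ p := by
    rw [habs, CFC.rpow_eq_cfc_real hpos.nonneg, hH.cfc_eq, IsHermitian.cfc,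
      Unitary.conjStarAlgAut_apply,
      trace_unitary_conj hH.eigenvectorUnitary.2, trace_diagonal]
    simp only [Function.comp_apply, Complex.re_sum, RCLike.ofReal_eq_complex_ofReal, Complex.ofReal_re]
    exact sum_eigenvalues_comp hH hV rfl (fun x => x ^ p)
  rw [schattenNorm, htr]

theorem schattenNorm_nonneg (p : ℝ) (M : Mat n) : 0 ≤ schattenNorm p M := by
  obtain ⟨U, hU, V, hV, d, hd, h⟩ := exists_svd_complex M
  rw [schattenNorm_svd p hU hV hd h]
  exact Real.rpow_nonneg (Finset.sum_nonneg fun i _ => Real.rpow_nonneg (hd i) _) _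

theorem schattenNorm_rpow {p : ℝ} (hp : p ≠ 0) {M U V : Mat n} (hU : U ∈ unitaryGroup n ℂ)
    (hV : V ∈ unitaryGroup n ℂ) {d : n → ℝ} (hd : ∀ i, 0 ≤ d i)
    (h : M = U * diagonal (fun i => (d i : ℂ)) * star V) :
    schattenNorm p M ^ p = ∑ i, d i ^ p := by
  rw [schattenNorm_svd p hU hV hd h, ← Real.rpow_mul
    (Finset.sum_nonneg fun i _ => Real.rpow_nonneg (hd i) _), one_div_mul_cancel hp, Real.rpow_one]

theorem schattenNorm_rpow_posSemidef {p : ℝ} (hp : p ≠ 0) {M : Mat n} (hM : M.PosSemidef) :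
    schattenNorm p M ^ p = ∑ i, hM.1.eigenvalues i ^ p := by
  obtain ⟨U, hU, h⟩ := hM.1.exists_unitary_diagonal_complex
  exact schattenNorm_rpow hp hU hU hM.eigenvalues_nonneg h

theorem schattenNorm_unitary_mul (p : ℝ) {W : Mat n} (hW : W ∈ unitaryGroup n ℂ) (M : Mat n) :
    schattenNorm p (W * M) = schattenNorm p M := by
  obtain ⟨U, hU, V, hV, d, hd, h⟩ := exists_svd_complex M
  rw [schattenNorm_svd p hU hV hd h, schattenNorm_svd p (mul_mem hW hU) hV hd]
  rw [h]; simp only [Matrix.mul_assoc]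

theorem schattenNorm_mul_unitary (p : ℝ) {W : Mat n} (hW : W ∈ unitaryGroup n ℂ) (M : Mat n) :
    schattenNorm p (M * W) = schattenNorm p M := by
  obtain ⟨U, hU, V, hV, d, hd, h⟩ := exists_svd_complex M
  rw [schattenNorm_svd p hU hV hd h, schattenNorm_svd p hU (mul_mem (Unitary.star_mem hW) hV) hd]
  rw [h]; simp only [Matrix.mul_assoc, star_mul, star_star]

theorem schattenNorm_star (p : ℝ) (M : Mat n) : schattenNorm p (star M) = schattenNorm p M := by
  obtain ⟨U, hU, V, hV, d, hd, h⟩ := exists_svd_complex M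
  rw [schattenNorm_svd p hU hV hd h, schattenNorm_svd p hV hU hd]
  rw [h]; simp only [Matrix.mul_assoc, star_mul, star_star, star_diagonal_ofReal]

theorem submatrix_mem_unitaryGroup {m : Type*} [Fintype m] [DecidableEq m] (e : m ≃ n) {U : Mat n}
    (hU : U ∈ unitaryGroup n ℂ) : U.submatrix e e ∈ unitaryGroup m ℂ := by
  rw [mem_unitaryGroup_iff, star_eq_conjTranspose, conjTranspose_submatrix,
    submatrix_mul_equiv, ← star_eq_conjTranspose, (mem_unitaryGroup_iff).1 hU, submatrix_one_equiv]

theorem schattenNorm_submatrix {m : Type*} [Fintype m] [DecidableEq m] (p : ℝ) (e : m ≃ n)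
    (M : Mat n) : schattenNorm p (M.submatrix e e) = schattenNorm p M := by
  obtain ⟨U, hU, V, hV, d, hd, h⟩ := exists_svd_complex M
  rw [schattenNorm_svd p hU hV hd h, schattenNorm_svd p (d := d ∘ e)
    (submatrix_mem_unitaryGroup e hU) (submatrix_mem_unitaryGroup e hV) (fun i => hd _)]
  · congr 1
    exact Equiv.sum_comp e (fun i => d i ^ p)
  · rw [h, ← submatrix_mul_equiv _ _ e e e, ← submatrix_mul_equiv _ _ e e e,
      submatrix_diagonal_equiv]
    rfl

theorem schattenNorm_kronecker {m : Type*} [Fintype m] [DecidableEq m] (p : ℝ) (A : Mat n)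
    (B : Mat m) : schattenNorm p (A ⊗ₖ B) = schattenNorm p A * schattenNorm p B := by
  obtain ⟨U, hU, V, hV, d, hd, h⟩ := exists_svd_complex A
  obtain ⟨U', hU', V', hV', d', hd', h'⟩ := exists_svd_complex B
  rw [schattenNorm_svd p hU hV hd h, schattenNorm_svd p hU' hV' hd' h',
    schattenNorm_svd p (d := fun i : n × m => d i.1 * d' i.2) (kronecker_mem_unitary hU hU')
      (kronecker_mem_unitary hV hV') (fun i => mul_nonneg (hd _) (hd' _)),
    ← Real.mul_rpow (Finset.sum_nonneg fun i _ => Real.rpow_nonneg (hd i) _)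
      (Finset.sum_nonneg fun i _ => Real.rpow_nonneg (hd' i) _), Finset.sum_mul_sum,
    Fintype.sum_prod_type]
  · simp only [Real.mul_rpow (hd _) (hd' _)]
  · rw [h, h', mul_kronecker_mul, mul_kronecker_mul, diagonal_kronecker_diagonal]
    simp only [star_eq_conjTranspose, conjTranspose_kronecker, Complex.ofReal_mul]

theorem schattenNorm_eq_zero {p : ℝ} (hp : 0 < p) {M : Mat n} (h0 : schattenNorm p M = 0) :
    M = 0 := by
  obtain ⟨U, hU, V, hV, d, hd, h⟩ := exists_svd_complex M
  have h1 := schattenNorm_rpow hp.ne' hU hV hd h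
  rw [h0, Real.zero_rpow hp.ne', eq_comm,
    Finset.sum_eq_zero_iff_of_nonneg fun i _ => Real.rpow_nonneg (hd i) _] at h1
  have h2 : (fun i => (d i : ℂ)) = 0 := by
    ext i
    have := (Real.rpow_eq_zero (hd i) hp.ne').1 (h1 i (Finset.mem_univ i))
    simp [this]
  rw [h, show diagonal (fun i => (d i : ℂ)) = 0 by rw [h2, Pi.zero_def, diagonal_zero]]
  simp

theorem schattenNorm_zero {p : ℝ} (hp : 0 < p) : schattenNorm p (0 : Mat n) = 0 := by
  rw [schattenNorm_svd p (one_mem _) (one_mem _) (d := fun _ => 0) (fun i => le_rfl) (by simp)]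
  simp [Real.zero_rpow hp.ne', Real.zero_rpow (inv_ne_zero hp.ne')]

theorem schattenNorm_pos {p : ℝ} (hp : 0 < p) {M : Mat n} (h0 : M ≠ 0) : 0 < schattenNorm p M :=
  (schattenNorm_nonneg p M).lt_of_ne fun h => h0 (schattenNorm_eq_zero hp h.symm)

theorem schattenNorm_smul {p : ℝ} (hp : 0 < p) (c : ℂ) (M : Mat n) :
    schattenNorm p (c • M) = ‖c‖ * schattenNorm p M := by
  obtain ⟨U, hU, V, hV, d, hd, h⟩ := exists_svd_complex M
  -- Polar form of `c`: the phase is absorbed into the left unitary and the modulus into the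
  -- singular values.
  obtain ⟨w, hw, hcw⟩ : ∃ w : ℂ, star w * w = 1 ∧ c = w * ‖c‖ := by
    by_cases hc : c = 0
    · exact ⟨1, by simp, by simp [hc]⟩
    · have hc' : (‖c‖ : ℂ) ≠ 0 := by simpa using hc
      refine ⟨c / ‖c‖, ?_, by field_simp⟩
      rw [star_div₀, Complex.star_def, Complex.conj_ofReal, div_mul_div_comm, Complex.conj_mul']
      field_simp
  have hw' : w * star w = 1 := by rw [mul_comm]; exact hw
  have hwU : w • U ∈ unitaryGroup n ℂ := by
    rw [mem_unitaryGroup_iff, star_smul, smul_mul_smul_comm, (mem_unitaryGroup_iff).1 hU, hw',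
      one_smul]
  rw [schattenNorm_svd p hwU hV (d := fun i => ‖c‖ * d i) (fun i => mul_nonneg (norm_nonneg _)
    (hd i)) (M := c • M), schattenNorm_svd p hU hV hd h]
  · simp only [Real.mul_rpow (norm_nonneg _) (hd _), ← Finset.mul_sum]
    rw [Real.mul_rpow (Real.rpow_nonneg (norm_nonneg _) _)
      (Finset.sum_nonneg fun i _ => Real.rpow_nonneg (hd i) _), ← Real.rpow_mul (norm_nonneg _),
      mul_one_div_cancel hp.ne', Real.rpow_one]
  · have : diagonal (fun i => ((‖c‖ * d i : ℝ) : ℂ)) = (‖c‖ : ℂ) • diagonal (fun i => (d i : ℂ)) := by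
      rw [← diagonal_smul]; congr 1; ext i; simp
    rw [this, h, smul_mul_assoc, mul_smul_comm, smul_mul_assoc, smul_mul_assoc, smul_smul, ← hcw]

end Schatten

/-! ### Hölder duality and the triangle inequality -/

section Duality

variable {n : Type*} [Fintype n] [DecidableEq n]

theorem sum_sq_norm_row {U : Mat n} (hU : U ∈ unitaryGroup n ℂ) (i : n) :
    ∑ j, ‖U i j‖ ^ 2 = 1 := by
  have h := congrFun (congrFun ((mem_unitaryGroup_iff).1 hU) i) i
  rw [Matrix.mul_apply, one_apply_eq] at h
  have : ((∑ j, ‖U i j‖ ^ 2 : ℝ) : ℂ) = 1 := by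
    rw [← h]
    push_cast
    exact Finset.sum_congr rfl fun k _ => by
      rw [star_apply, Complex.star_def, Complex.mul_conj']
  exact_mod_cast this

theorem sum_sq_norm_col {U : Mat n} (hU : U ∈ unitaryGroup n ℂ) (j : n) :
    ∑ i, ‖U i j‖ ^ 2 = 1 := by
  have := sum_sq_norm_row (Unitary.star_mem hU) j
  simpa [star_apply] using this

/-- Hölder's inequality for sums weighted by a doubly stochastic matrix. -/
theorem sum_doublyStochastic_le {n : Type*} [Fintype n] {p q : ℝ} (hpq : p.HolderConjugate q) {d e : n → ℝ}
    (hd : ∀ i, 0 ≤ d i) (he : ∀ i, 0 ≤ e i) {t : n → n → ℝ} (ht : ∀ i j, 0 ≤ t i j)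
    (hrow : ∀ i, ∑ j, t i j = 1) (hcol : ∀ j, ∑ i, t i j = 1) :
    ∑ i, ∑ j, d i * e j * t i j ≤ (∑ i, d i ^ p) ^ (1 / p) * (∑ j, e j ^ q) ^ (1 / q) := by
  have h := Real.inner_le_Lp_mul_Lq_of_nonneg (Finset.univ : Finset (n × n)) hpq
    (f := fun x => d x.1 * t x.1 x.2 ^ (1 / p)) (g := fun x => e x.2 * t x.1 x.2 ^ (1 / q))
    (fun x _ => mul_nonneg (hd _) (Real.rpow_nonneg (ht _ _) _))
    (fun x _ => mul_nonneg (he _) (Real.rpow_nonneg (ht _ _) _))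
  have hp := hpq.pos
  have hq := hpq.symm.pos
  have h1 : ∑ x : n × n, (d x.1 * t x.1 x.2 ^ (1 / p)) ^ p = ∑ i, d i ^ p := by
    rw [Fintype.sum_prod_type]
    refine Finset.sum_congr rfl fun i _ => ?_
    calc _ = ∑ j, d i ^ p * t i j := Finset.sum_congr rfl fun j _ => by
          rw [Real.mul_rpow (hd _) (Real.rpow_nonneg (ht _ _) _), ← Real.rpow_mul (ht _ _),
            one_div_mul_cancel hp.ne', Real.rpow_one]
      _ = _ := by rw [← Finset.mul_sum, hrow, mul_one]
  have h2 : ∑ x : n × n, (e x.2 * t x.1 x.2 ^ (1 / q)) ^ q = ∑ i, e i ^ q := by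
    rw [Fintype.sum_prod_type_right]
    refine Finset.sum_congr rfl fun j _ => ?_
    calc _ = ∑ i, e j ^ q * t i j := Finset.sum_congr rfl fun i _ => by
          rw [Real.mul_rpow (he _) (Real.rpow_nonneg (ht _ _) _), ← Real.rpow_mul (ht _ _),
            one_div_mul_cancel hq.ne', Real.rpow_one]
      _ = _ := by rw [← Finset.mul_sum, hcol, mul_one]
  rw [h1, h2, Fintype.sum_prod_type] at h
  refine le_of_eq_of_le (Finset.sum_congr rfl fun i _ => Finset.sum_congr rfl fun j _ => ?_) h
  have h3 : t i j ^ (1 / p) * t i j ^ (1 / q) = t i j := by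
    rw [← Real.rpow_add_of_nonneg (ht _ _) (by positivity) (by positivity), one_div, one_div,
      hpq.inv_add_inv_eq_one, Real.rpow_one]
  calc d i * e j * t i j = d i * e j * (t i j ^ (1 / p) * t i j ^ (1 / q)) := by rw [h3]
    _ = _ := by ring

/-- In terms of the two singular value decompositions the trace is Σ dᵢ eⱼ Wᵢⱼ Zⱼᵢ with W and Z
unitary. The modulus of Wᵢⱼ Zⱼᵢ is at most the mean of the two squared moduli, and these means form
a doubly stochastic matrix. -/
theorem norm_trace_mul_le {p q : ℝ} (hpq : p.HolderConjugate q) (A B : Mat n) :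
    ‖(A * B).trace‖ ≤ schattenNorm p A * schattenNorm q B := by
  obtain ⟨U, hU, V, hV, d, hd, hA⟩ := exists_svd_complex A
  obtain ⟨U', hU', V', hV', e, he, hB⟩ := exists_svd_complex B
  have hW : star V * U' ∈ unitaryGroup n ℂ := mul_mem (Unitary.star_mem hV) hU'
  have hZ : star V' * U ∈ unitaryGroup n ℂ := mul_mem (Unitary.star_mem hV') hU
  set W := star V * U' with hWdef
  set Z := star V' * U with hZdef
  have htr : (A * B).trace = ∑ i, ∑ j, (d i * e j : ℂ) * (W i j * Z j i) := by
    have h1 : (A * B).trace = ((diagonal (fun i => (d i : ℂ)) * W) *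
        (diagonal (fun i => (e i : ℂ)) * Z)).trace := by
      calc (A * B).trace = (U * (diagonal (fun i => (d i : ℂ)) * (star V * (U' *
          (diagonal (fun i => (e i : ℂ)) * star V'))))).trace := by
            rw [hA, hB]; simp only [Matrix.mul_assoc]
        _ = _ := by rw [trace_mul_comm]; simp only [hWdef, hZdef, Matrix.mul_assoc]
    rw [h1, Matrix.trace]
    refine Finset.sum_congr rfl fun i _ => ?_
    rw [diag_apply, Matrix.mul_apply]
    refine Finset.sum_congr rfl fun j _ => ?_
    rw [diagonal_mul, diagonal_mul]
    ring
  rw [htr, schattenNorm_svd p hU hV hd hA, schattenNorm_svd q hU' hV' he hB]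
  refine le_trans ?_ (sum_doublyStochastic_le hpq hd he
    (t := fun i j => (‖W i j‖ ^ 2 + ‖Z j i‖ ^ 2) / 2) (fun i j => by positivity) (fun i => ?_)
    (fun j => ?_))
  · refine (norm_sum_le _ _).trans (Finset.sum_le_sum fun i _ => (norm_sum_le _ _).trans
      (Finset.sum_le_sum fun j _ => ?_))
    rw [norm_mul, norm_mul, norm_mul, Complex.norm_real, Complex.norm_real, Real.norm_eq_abs,
      Real.norm_eq_abs, abs_of_nonneg (hd i), abs_of_nonneg (he j)]
    refine mul_le_mul_of_nonneg_left ?_ (mul_nonneg (hd i) (he j))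
    nlinarith [sq_nonneg (‖W i j‖ - ‖Z j i‖)]
  · rw [← Finset.sum_div, Finset.sum_add_distrib, sum_sq_norm_row hW, sum_sq_norm_col hZ]
    norm_num
  · rw [← Finset.sum_div, Finset.sum_add_distrib, sum_sq_norm_col hW, sum_sq_norm_row hZ]
    norm_num

theorem rpow_sub_one_rpow_conj {p q : ℝ} (hpq : p.HolderConjugate q) {x : ℝ} (hx : 0 ≤ x) :
    (x ^ (p - 1)) ^ q = x ^ p := by
  rw [← Real.rpow_mul hx, hpq.sub_one_mul_conj]

theorem rpow_sub_one_mul_self {p x : ℝ} (hp : p ≠ 0) (hx : 0 ≤ x) : x * x ^ (p - 1) = x ^ p := by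
  rcases hx.eq_or_lt with h | h
  · rw [← h, Real.zero_rpow hp, zero_mul]
  · rw [Real.rpow_sub_one h.ne']; field_simp

/-- Every matrix has a dual matrix attaining equality in Hölder's inequality. -/
theorem exists_dual {p q : ℝ} (hpq : p.HolderConjugate q) (A : Mat n) :
    ∃ B : Mat n, (A * B).trace = ((schattenNorm p A ^ p : ℝ) : ℂ) ∧
      schattenNorm q B = schattenNorm p A ^ (p - 1) ∧ (A.PosSemidef → B.PosSemidef) := by
  -- The dual of U D V* is V D^(p-1) U*. For positive A the spectral theorem allows U = V, which
  -- makes the dual positive.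
  suffices H : ∃ U ∈ unitaryGroup n ℂ, ∃ V ∈ unitaryGroup n ℂ, ∃ d : n → ℝ, (∀ i, 0 ≤ d i) ∧
      A = U * diagonal (fun i => (d i : ℂ)) * star V ∧ (A.PosSemidef → U = V) by
    obtain ⟨U, hU, V, hV, d, hd, hA, hUV⟩ := H
    have hd' (i : n) : 0 ≤ d i ^ (p - 1) := Real.rpow_nonneg (hd i) _
    refine ⟨V * diagonal (fun i => ((d i ^ (p - 1) : ℝ) : ℂ)) * star U, ?_, ?_, ?_⟩
    · calc _ = (U * (diagonal (fun i => (d i : ℂ)) * ((star V * V) *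
          (diagonal (fun i => ((d i ^ (p - 1) : ℝ) : ℂ))))) * star U).trace := by
            rw [hA]; simp only [Matrix.mul_assoc]
        _ = ∑ i, ((d i * d i ^ (p - 1) : ℝ) : ℂ) := by
            rw [(mem_unitaryGroup_iff').1 hV, trace_unitary_conj hU, Matrix.one_mul,
              diagonal_mul_diagonal, trace_diagonal]
            simp
        _ = _ := by
            rw [schattenNorm_rpow hpq.pos.ne' hU hV hd hA]
            push_cast
            refine Finset.sum_congr rfl fun i _ => ?_
            rw [← Complex.ofReal_mul]
            rw [rpow_sub_one_mul_self hpq.pos.ne' (hd i)]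
    · rw [schattenNorm_svd q hV hU hd' rfl, schattenNorm_svd p hU hV hd hA]
      simp only [rpow_sub_one_rpow_conj hpq (hd _)]
      rw [← Real.rpow_mul (Finset.sum_nonneg fun i _ => Real.rpow_nonneg (hd i) _)]
      congr 1
      have := hpq.sub_one_mul_conj
      have h1 := hpq.pos.ne'
      have h2 := hpq.symm.pos.ne'
      field_simp
      linarith
    · intro hpos
      rw [← hUV hpos]
      exact posSemidef_unitary_diagonal U hd'
  by_cases hpos : A.PosSemidef
  · obtain ⟨U, hU, h⟩ := hpos.1.exists_unitary_diagonal_complex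
    exact ⟨U, hU, U, hU, _, hpos.eigenvalues_nonneg, h, fun _ => rfl⟩
  · obtain ⟨U, hU, V, hV, d, hd, h⟩ := exists_svd_complex A
    exact ⟨U, hU, V, hV, d, hd, h, fun h => absurd h hpos⟩

/-- Pair A + B with its dual matrix, apply Hölder to each summand, and cancel the norm of the dual.
-/
theorem schattenNorm_add_le {p : ℝ} (hp : 1 < p) (A B : Mat n) :
    schattenNorm p (A + B) ≤ schattenNorm p A + schattenNorm p B := by
  have hpq := Real.HolderConjugate.conjExponent hp
  by_cases h0 : A + B = 0
  · rw [h0, schattenNorm_zero (by linarith)]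
    exact add_nonneg (schattenNorm_nonneg _ _) (schattenNorm_nonneg _ _)
  obtain ⟨C, h1, h2, -⟩ := exists_dual hpq (A + B)
  have hpos := schattenNorm_pos (by linarith : 0 < p) h0
  have h3 : schattenNorm p (A + B) ^ p ≤
      (schattenNorm p A + schattenNorm p B) * schattenNorm p (A + B) ^ (p - 1) := by
    calc schattenNorm p (A + B) ^ p = ‖((A + B) * C).trace‖ := by
          rw [h1, Complex.norm_real, Real.norm_of_nonneg (Real.rpow_nonneg hpos.le _)]
      _ = ‖(A * C).trace + (B * C).trace‖ := by rw [Matrix.add_mul, trace_add]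
      _ ≤ _ := (norm_add_le _ _).trans (add_le_add (norm_trace_mul_le hpq A C)
          (norm_trace_mul_le hpq B C))
      _ = _ := by rw [h2]; ring
  rw [← rpow_sub_one_mul_self (by linarith) hpos.le] at h3
  exact le_of_mul_le_mul_right h3 (Real.rpow_pos_of_pos hpos _)

end Duality

/-! ### Positive 2 × 2 block matrices -/

section Blocks

variable {n : Type*} [Fintype n] [DecidableEq n]

/-- The diagonal entries of a positive matrix are dominated by numbers with the same `p`-norm as the
matrix: those of `(A ^ p) i i ^ (1 / p)`. -/
theorem exists_diag_majorant {p : ℝ} (hp : 1 ≤ p) {A : Mat n} (hA : A.PosSemidef) :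
    ∃ x : n → ℝ, (∀ i, 0 ≤ x i) ∧ (∀ i, (A i i).re ≤ x i) ∧
      ∑ i, x i ^ p = schattenNorm p A ^ p := by
  have hp0 : 0 < p := by linarith
  obtain ⟨U, hU, h⟩ := hA.1.exists_unitary_diagonal_complex
  set μ := hA.1.eigenvalues with hμ
  have hμ0 : ∀ i, 0 ≤ μ i := hA.eigenvalues_nonneg
  have hs (i : n) : 0 ≤ ∑ j, ‖U i j‖ ^ 2 * μ j ^ p :=
    Finset.sum_nonneg fun j _ => mul_nonneg (sq_nonneg _) (Real.rpow_nonneg (hμ0 j) _)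
  -- The squared moduli of the entries of `U` are weights summing to one along rows, which gives the
  -- bound by the power mean inequality, and along columns, which gives the equality of power sums.
  refine ⟨fun i => (∑ j, ‖U i j‖ ^ 2 * μ j ^ p) ^ (1 / p), fun i => Real.rpow_nonneg (hs i) _,
    fun i => ?_, ?_⟩
  · have h1 : (A i i).re = ∑ j, ‖U i j‖ ^ 2 * μ j := by
      have : A i i = ((∑ j, ‖U i j‖ ^ 2 * μ j : ℝ) : ℂ) := by
        conv_lhs => rw [h]
        rw [Matrix.mul_apply]
        push_cast
        refine Finset.sum_congr rfl fun j _ => ?_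
        rw [mul_diagonal, star_apply, Complex.star_def, ← Complex.mul_conj']
        ring
      rw [this, Complex.ofReal_re]
    rw [h1]
    exact Real.arith_mean_le_rpow_mean _ _ _ (fun j _ => sq_nonneg _) (sum_sq_norm_row hU i)
      (fun j _ => hμ0 j) hp
  · simp only [← Real.rpow_mul (hs _), one_div_mul_cancel hp0.ne', Real.rpow_one]
    rw [Finset.sum_comm, schattenNorm_rpow hp0.ne' hU hU hμ0 h]
    exact Finset.sum_congr rfl fun j _ => by rw [← Finset.sum_mul, sum_sq_norm_col hU, one_mul]

theorem fromBlocks_diag_mem_unitaryGroup {U V : Mat n} (hU : U ∈ unitaryGroup n ℂ)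
    (hV : V ∈ unitaryGroup n ℂ) : fromBlocks U 0 0 V ∈ unitaryGroup (n ⊕ n) ℂ := by
  rw [mem_unitaryGroup_iff, star_eq_conjTranspose, fromBlocks_conjTranspose, fromBlocks_multiply]
  simp only [← star_eq_conjTranspose, (mem_unitaryGroup_iff).1 hU, (mem_unitaryGroup_iff).1 hV]
  simp

theorem schattenNorm_unitary_conj (p : ℝ) {U V : Mat n} (hU : U ∈ unitaryGroup n ℂ)
    (hV : V ∈ unitaryGroup n ℂ) (A : Mat n) :
    schattenNorm p (U * A * V) = schattenNorm p A := by
  rw [schattenNorm_mul_unitary p hV, schattenNorm_unitary_mul p hU]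

/-- A positive block matrix is unitarily equivalent to one whose off-diagonal blocks are diagonal. -/
theorem exists_diagonal_offDiagonal {X Y Z : Mat n} (hM : (fromBlocks X Y Yᴴ Z).PosSemidef) :
    ∃ (X' Z' : Mat n) (y : n → ℝ), (∀ i, 0 ≤ y i) ∧
      (fromBlocks X' (diagonal fun i => (y i : ℂ)) (diagonal fun i => (y i : ℂ)) Z').PosSemidef ∧
      (∀ p, schattenNorm p X' = schattenNorm p X) ∧ (∀ p, schattenNorm p Z' = schattenNorm p Z) ∧
      (∀ p, p ≠ 0 → schattenNorm p Y ^ p = ∑ i, y i ^ p) ∧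
      ∀ p, schattenNorm p (fromBlocks X' (diagonal fun i => (y i : ℂ))
        (diagonal fun i => (y i : ℂ)) Z') = schattenNorm p (fromBlocks X Y Yᴴ Z) := by
  -- Conjugation by the block diagonal unitary with blocks U* and V* turns Y = U D V* into D and
  -- only rotates the diagonal blocks.
  obtain ⟨U, hU, V, hV, y, hy, h⟩ := exists_svd_complex Y
  have hW := fromBlocks_diag_mem_unitaryGroup (Unitary.star_mem hU) (Unitary.star_mem hV)
  have hU1 := (mem_unitaryGroup_iff').1 hU
  have hV1 := (mem_unitaryGroup_iff').1 hV
  have hYd : star U * Y * V = diagonal (fun i => (y i : ℂ)) := by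
    calc star U * Y * V = (star U * U) * diagonal (fun i => (y i : ℂ)) * (star V * V) := by
          rw [h]; simp only [Matrix.mul_assoc]
      _ = _ := by rw [hU1, hV1]; simp
  have hYd' : star V * Yᴴ * U = diagonal (fun i => (y i : ℂ)) := by
    rw [← star_diagonal_ofReal, ← hYd]
    simp only [star_mul, star_star, Matrix.mul_assoc]
    rfl
  have hblock : fromBlocks (star U * X * U) (diagonal fun i => (y i : ℂ))
      (diagonal fun i => (y i : ℂ)) (star V * Z * V) =
      fromBlocks (star U) 0 0 (star V) * fromBlocks X Y Yᴴ Z *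
        (fromBlocks (star U) 0 0 (star V))ᴴ := by
    rw [fromBlocks_conjTranspose, fromBlocks_multiply, fromBlocks_multiply]
    simp only [Matrix.zero_mul, Matrix.mul_zero, add_zero, zero_add, conjTranspose_zero]
    simp only [← star_eq_conjTranspose, star_star]
    rw [star_eq_conjTranspose Y, hYd', hYd]
  refine ⟨star U * X * U, star V * Z * V, y, hy, ?_,
    fun p => schattenNorm_unitary_conj p (Unitary.star_mem hU) hU _,
    fun p => schattenNorm_unitary_conj p (Unitary.star_mem hV) hV _,
    fun p hp => schattenNorm_rpow hp hU hV hy h, fun p => ?_⟩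
  · rw [hblock]
    exact hM.mul_mul_conjTranspose_same _
  · rw [hblock, ← star_eq_conjTranspose]
    exact schattenNorm_unitary_conj p hW (Unitary.star_mem hW) _

theorem posSemidef_block_left {n : Type*} {X Y Y' Z : Mat n} (hM : (fromBlocks X Y Y' Z).PosSemidef) :
    X.PosSemidef := by
  have := hM.submatrix Sum.inl
  exact this

theorem posSemidef_block_right {n : Type*} {X Y Y' Z : Mat n} (hM : (fromBlocks X Y Y' Z).PosSemidef) :
    Z.PosSemidef := by
  have := hM.submatrix Sum.inr
  exact this

theorem posSemidef_diag_re {n : Type*} {X : Mat n} (hX : X.PosSemidef) (i : n) :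
    0 ≤ (X i i).re ∧ X i i = ((X i i).re : ℂ) := by
  have := hX.diag_nonneg (i := i)
  rw [Complex.nonneg_iff] at this
  exact ⟨this.1, Complex.ext rfl (by simpa using this.2.symm)⟩

theorem sq_norm_le_of_posSemidef {n : Type*} {A : Mat n} (hA : A.PosSemidef) (i j : n) :
    ‖A i j‖ ^ 2 ≤ (A i i).re * (A j j).re := by
  have h := (hA.submatrix (![i, j] : Fin 2 → n)).det_nonneg
  rw [det_fin_two] at h
  simp only [submatrix_apply, cons_val_zero, cons_val_one] at h
  rw [(posSemidef_diag_re hA i).2, (posSemidef_diag_re hA j).2, ← hA.1.apply j i, Complex.star_def,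
    Complex.mul_conj'] at h
  have h' : (0 : ℝ) ≤ (A i i).re * (A j j).re - ‖A i j‖ ^ 2 := by exact_mod_cast h
  linarith

theorem sq_le_of_posSemidef_fromBlocks {n : Type*} [DecidableEq n] {X Z : Mat n} {y : n → ℝ}
    (hM : (fromBlocks X (diagonal fun i => (y i : ℂ)) (diagonal fun i => (y i : ℂ)) Z).PosSemidef)
    (i : n) : y i ^ 2 ≤ (X i i).re * (Z i i).re := by
  simpa using sq_norm_le_of_posSemidef hM (Sum.inl i) (Sum.inr i)

/-- The off-diagonal block of a positive block matrix is dominated by the geometric mean of the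
diagonal blocks. -/
theorem schattenNorm_offDiagonal_sq_le {p : ℝ} (hp : 1 ≤ p) {X Y Z : Mat n}
    (hM : (fromBlocks X Y Yᴴ Z).PosSemidef) :
    schattenNorm p Y ^ 2 ≤ schattenNorm p X * schattenNorm p Z := by
  have hp0 : 0 < p := by linarith
  obtain ⟨X', Z', y, hy, hM', hX', hZ', hY, -⟩ := exists_diagonal_offDiagonal hM
  obtain ⟨x, hx0, hx, hxs⟩ := exists_diag_majorant hp (posSemidef_block_left hM')
  obtain ⟨z, hz0, hz, hzs⟩ := exists_diag_majorant hp (posSemidef_block_right hM')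
  rw [hX'] at hxs
  rw [hZ'] at hzs
  -- The 2 × 2 minors give the estimate one singular value at a time; Cauchy–Schwarz then sums the
  -- p-th powers.
  have h1 (i : n) : y i ^ 2 ≤ x i * z i := (sq_le_of_posSemidef_fromBlocks hM' i).trans
    (mul_le_mul (hx i) (hz i) (posSemidef_diag_re (posSemidef_block_right hM') i).1 (hx0 i))
  have h2 (i : n) : y i ^ p ≤ √(x i ^ p) * √(z i ^ p) := by
    rw [← Real.sqrt_mul (Real.rpow_nonneg (hx0 i) _), ← Real.mul_rpow (hx0 i) (hz0 i)]
    refine Real.le_sqrt_of_sq_le ?_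
    rw [← Real.rpow_natCast, ← Real.rpow_mul (hy i), mul_comm, Real.rpow_mul (hy i)]
    refine Real.rpow_le_rpow (Real.rpow_nonneg (hy i) _) ?_ hp0.le
    rw [Real.rpow_natCast]
    exact h1 i
  have hXn := schattenNorm_nonneg p X
  have hYn := schattenNorm_nonneg p Y
  have hZn := schattenNorm_nonneg p Z
  have h3 : schattenNorm p Y ^ p ≤ √(schattenNorm p X ^ p) * √(schattenNorm p Z ^ p) := by
    rw [hY p hp0.ne', ← hxs, ← hzs]
    exact (Finset.sum_le_sum fun i _ => h2 i).trans (Real.sum_sqrt_mul_sqrt_le _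
      (fun i => Real.rpow_nonneg (hx0 i) _) (fun i => Real.rpow_nonneg (hz0 i) _))
  rw [← Real.sqrt_mul (Real.rpow_nonneg hXn _), ← Real.mul_rpow hXn hZn] at h3
  have h4 := Real.sq_sqrt (Real.rpow_nonneg (mul_nonneg hXn hZn) p)
  have h5 : (schattenNorm p Y ^ 2) ^ p ≤ (schattenNorm p X * schattenNorm p Z) ^ p := by
    rw [← h4, ← Real.rpow_natCast, ← Real.rpow_mul hYn, mul_comm, Real.rpow_mul hYn,
      Real.rpow_natCast]
    exact pow_le_pow_left₀ (Real.rpow_nonneg hYn _) h3 2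
  exact (Real.rpow_le_rpow_iff (by positivity) (by positivity) hp0).1 h5

end Blocks

/-! ### Integral representation of powers by logarithms -/

section PowerComparison

open MeasureTheory Set

/-- The kernel `t - log (1 + t)` of the integral representation of `t ^ p`, `1 < p < 2`. -/
def logDefect (t : ℝ) : ℝ := t - Real.log (1 + t)

theorem logDefect_nonneg {t : ℝ} (ht : 0 ≤ t) : 0 ≤ logDefect t := by
  have := Real.log_le_sub_one_of_pos (by linarith : 0 < 1 + t)
  rw [logDefect]; linarith

theorem logDefect_le_self {t : ℝ} (ht : 0 ≤ t) : logDefect t ≤ t := by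
  have := Real.log_nonneg (by linarith : 1 ≤ 1 + t)
  rw [logDefect]; linarith

theorem logDefect_le_sq {t : ℝ} (ht : 0 ≤ t) : logDefect t ≤ t ^ 2 := by
  have h := Real.one_sub_inv_le_log_of_pos (by linarith : 0 < 1 + t)
  have h1 : t - (1 - (1 + t)⁻¹) ≤ t ^ 2 := by
    have h2 : (1 + t)⁻¹ * (1 + t) = 1 := inv_mul_cancel₀ (by linarith)
    have h3 : 0 < (1 + t)⁻¹ := by positivity
    nlinarith [mul_nonneg ht ht, mul_nonneg (mul_nonneg ht ht) ht, mul_nonneg ht h3.le]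
  rw [logDefect]; linarith

theorem logDefect_pos {t : ℝ} (ht : 0 < t) : 0 < logDefect t := by
  have := Real.log_lt_sub_one_of_pos (by linarith : 0 < 1 + t) (by linarith)
  rw [logDefect]; linarith

theorem continuousOn_rpow_mul_logDefect (p : ℝ) {t : ℝ} (ht : 0 ≤ t) :
    ContinuousOn (fun u : ℝ => u ^ (-p - 1) * logDefect (t * u)) (Ioi 0) := by
  intro u hu
  have hu : 0 < u := hu
  have h1 : 1 + t * u ≠ 0 := by positivity
  have : ContinuousAt (fun u : ℝ => u ^ (-p - 1) * (t * u - Real.log (1 + t * u))) u := by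
    refine ContinuousAt.mul (Real.continuousAt_rpow_const _ _ (Or.inl hu.ne')) ?_
    exact ContinuousAt.sub (by fun_prop) (ContinuousAt.log (by fun_prop) h1)
  exact this.continuousWithinAt

/-- On (0, 1] the quadratic bound leaves u ^ (1 - p), integrable since p < 2; on (1, ∞) the linear
bound leaves u ^ (-p), integrable since p > 1. -/
theorem integrableOn_rpow_mul_logDefect {p : ℝ} (hp1 : 1 < p) (hp2 : p < 2) {t : ℝ} (ht : 0 ≤ t) :
    IntegrableOn (fun u : ℝ => u ^ (-p - 1) * logDefect (t * u)) (Ioi 0) := by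
  have hm : ∀ s ⊆ Ioi (0 : ℝ), MeasurableSet s → AEStronglyMeasurable
      (fun u : ℝ => u ^ (-p - 1) * logDefect (t * u)) (volume.restrict s) := fun s hs hms =>
    ((continuousOn_rpow_mul_logDefect p ht).mono hs).aestronglyMeasurable hms
  rw [← Ioc_union_Ioi_eq_Ioi (zero_le_one' ℝ)]
  refine IntegrableOn.union ?_ ?_
  · have h1 : IntegrableOn (fun u : ℝ => t ^ 2 * u ^ (1 - p)) (Ioc 0 1) := by
      have := (intervalIntegral.intervalIntegrable_rpow' (a := 0) (b := 1)
        (by linarith : -1 < 1 - p)).const_mul (t ^ 2)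
      rwa [intervalIntegrable_iff_integrableOn_Ioc_of_le zero_le_one] at this
    refine Integrable.mono' h1 (hm _ Ioc_subset_Ioi_self measurableSet_Ioc) ?_
    filter_upwards [ae_restrict_mem measurableSet_Ioc] with u hu
    have hu0 : 0 < u := hu.1
    have htu : 0 ≤ t * u := by positivity
    rw [Real.norm_of_nonneg (mul_nonneg (Real.rpow_nonneg hu0.le _) (logDefect_nonneg htu))]
    calc u ^ (-p - 1) * logDefect (t * u) ≤ u ^ (-p - 1) * (t * u) ^ 2 :=
          mul_le_mul_of_nonneg_left (logDefect_le_sq htu) (Real.rpow_nonneg hu0.le _)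
      _ = t ^ 2 * (u ^ (-p - 1) * u ^ (2 : ℝ)) := by rw [Real.rpow_two]; ring
      _ = t ^ 2 * u ^ (1 - p) := by rw [← Real.rpow_add hu0]; ring_nf
  · have h1 : IntegrableOn (fun u : ℝ => t * u ^ (-p)) (Ioi 1) :=
      (integrableOn_Ioi_rpow_of_lt (by linarith) zero_lt_one).const_mul t
    refine Integrable.mono' h1 (hm _ (Ioi_subset_Ioi zero_le_one) measurableSet_Ioi) ?_
    filter_upwards [ae_restrict_mem measurableSet_Ioi] with u hu
    have hu0 : 0 < u := zero_lt_one.trans hu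
    have htu : 0 ≤ t * u := by positivity
    rw [Real.norm_of_nonneg (mul_nonneg (Real.rpow_nonneg hu0.le _) (logDefect_nonneg htu))]
    calc u ^ (-p - 1) * logDefect (t * u) ≤ u ^ (-p - 1) * (t * u) :=
          mul_le_mul_of_nonneg_left (logDefect_le_self htu) (Real.rpow_nonneg hu0.le _)
      _ = t * (u ^ (-p - 1) * u ^ (1 : ℝ)) := by rw [Real.rpow_one]; ring
      _ = t * u ^ (-p) := by rw [← Real.rpow_add hu0]; ring_nf

/-- Scaling of the variable by t. Since the integral on the right is positive when 1 < p < 2, this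
represents t ^ p as an average of kernels that are linear minus logarithmic in t. -/
theorem integral_rpow_mul_logDefect {p : ℝ} (hp1 : 1 < p) {t : ℝ} (ht : 0 ≤ t) :
    ∫ u in Ioi (0 : ℝ), u ^ (-p - 1) * logDefect (t * u) =
      t ^ p * ∫ u in Ioi (0 : ℝ), u ^ (-p - 1) * logDefect u := by
  rcases ht.eq_or_lt with rfl | ht
  · simp [logDefect, Real.zero_rpow (by linarith : p ≠ 0)]
  have h := integral_comp_mul_left_Ioi (fun x : ℝ => x ^ (-p - 1) * logDefect x) 0 ht
  rw [mul_zero, smul_eq_mul] at h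
  have h2 : ∫ u in Ioi (0 : ℝ), (t * u) ^ (-p - 1) * logDefect (t * u) =
      t ^ (-p - 1) * ∫ u in Ioi (0 : ℝ), u ^ (-p - 1) * logDefect (t * u) := by
    rw [← integral_const_mul]
    refine setIntegral_congr_fun measurableSet_Ioi fun u hu => ?_
    have hu : 0 < u := hu
    simp only [Real.mul_rpow ht.le hu.le]
    ring
  rw [h2] at h
  have h3 : t ^ p * t ^ (-p - 1) = t⁻¹ := by
    rw [← Real.rpow_add ht, ← Real.rpow_neg_one]; ring_nf
  have h4 : t * t⁻¹ = 1 := mul_inv_cancel₀ ht.ne'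
  have h5 : t * t ^ p * t ^ (-p - 1) = 1 := by rw [mul_assoc, h3, h4]
  calc _ = (t * t ^ p * t ^ (-p - 1)) * ∫ u in Ioi (0 : ℝ), u ^ (-p - 1) * logDefect (t * u) := by
        rw [h5, one_mul]
    _ = t * t ^ p * (t⁻¹ * ∫ u in Ioi (0 : ℝ), u ^ (-p - 1) * logDefect u) := by
        rw [← h]; ring
    _ = (t * t⁻¹) * (t ^ p * ∫ u in Ioi (0 : ℝ), u ^ (-p - 1) * logDefect u) := by ring
    _ = _ := by rw [h4, one_mul]

theorem integral_rpow_mul_logDefect_pos {p : ℝ} (hp1 : 1 < p) (hp2 : p < 2) :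
    0 < ∫ u in Ioi (0 : ℝ), u ^ (-p - 1) * logDefect u := by
  have hint := integrableOn_rpow_mul_logDefect hp1 hp2 zero_le_one
  simp only [one_mul] at hint
  rw [setIntegral_pos_iff_support_of_nonneg_ae ?_ hint]
  · have : Function.support (fun u : ℝ => u ^ (-p - 1) * logDefect u) ∩ Ioi 0 = Ioi 0 := by
      refine inter_eq_right.2 fun u hu => ?_
      have hu : 0 < u := hu
      exact (mul_pos (Real.rpow_pos_of_pos hu _) (logDefect_pos hu)).ne'
    rw [this]
    simp
  · filter_upwards [ae_restrict_mem measurableSet_Ioi] with u hu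
    have hu : 0 < u := hu
    exact mul_nonneg (Real.rpow_nonneg hu.le _) (logDefect_nonneg hu.le)

/-- Domination of logarithms implies domination of power sums. -/
theorem sum_mul_rpow_nonneg {ι : Type*} [Fintype ι] {p : ℝ} (hp1 : 1 < p) (hp2 : p < 2)
    {w a : ι → ℝ} (ha : ∀ i, 0 ≤ a i) (hlin : ∑ i, w i * a i = 0)
    (hlog : ∀ u, 0 < u → ∑ i, w i * Real.log (1 + a i * u) ≤ 0) : 0 ≤ ∑ i, w i * a i ^ p := by
  have hκ := integral_rpow_mul_logDefect_pos hp1 hp2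
  refine (mul_nonneg_iff_of_pos_right hκ).1 ?_
  have h1 : (∑ i, w i * a i ^ p) * ∫ u in Ioi (0 : ℝ), u ^ (-p - 1) * logDefect u =
      ∫ u in Ioi (0 : ℝ), ∑ i, w i * (u ^ (-p - 1) * logDefect (a i * u)) := by
    rw [integral_finsetSum _ fun i _ =>
      (integrableOn_rpow_mul_logDefect hp1 hp2 (ha i)).const_mul (w i), Finset.sum_mul]
    refine Finset.sum_congr rfl fun i _ => ?_
    rw [integral_const_mul, integral_rpow_mul_logDefect hp1 (ha i), mul_assoc]
  rw [h1]
  refine setIntegral_nonneg measurableSet_Ioi fun u hu => ?_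
  have hu : 0 < u := hu
  -- The linear part of the kernel cancels by `hlin`, leaving minus the weighted sum of logarithms.
  have h2 : ∑ i, w i * (u ^ (-p - 1) * logDefect (a i * u)) =
      u ^ (-p - 1) * (u * ∑ i, w i * a i - ∑ i, w i * Real.log (1 + a i * u)) := by
    rw [Finset.mul_sum, ← Finset.sum_sub_distrib, Finset.mul_sum]
    refine Finset.sum_congr rfl fun i _ => ?_
    rw [logDefect]; ring
  rw [h2, hlin]
  exact mul_nonneg (Real.rpow_nonneg hu.le _) (by linarith [hlog u hu])

end PowerComparison

/-! ### Scalar 2 × 2 matrices and the excess of their power traces -/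

section TwoByTwo

open Set

/-- The larger eigenvalue of the real symmetric matrix `!![x, y; y, z]`. -/
def eigMax (x y z : ℝ) : ℝ := (x + z) / 2 + √(((x - z) / 2) ^ 2 + y ^ 2)

/-- The smaller eigenvalue of the real symmetric matrix `!![x, y; y, z]`. -/
def eigMin (x y z : ℝ) : ℝ := (x + z) / 2 - √(((x - z) / 2) ^ 2 + y ^ 2)

theorem eigMax_add_eigMin (x y z : ℝ) : eigMax x y z + eigMin x y z = x + z := by
  rw [eigMax, eigMin]; ring

theorem eigMax_mul_eigMin (x y z : ℝ) : eigMax x y z * eigMin x y z = x * z - y ^ 2 := by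
  have := Real.sq_sqrt (by positivity : 0 ≤ ((x - z) / 2) ^ 2 + y ^ 2)
  rw [eigMax, eigMin]; linear_combination -this

theorem eigMax_nonneg {x z : ℝ} (y : ℝ) (hx : 0 ≤ x) (hz : 0 ≤ z) : 0 ≤ eigMax x y z := by
  rw [eigMax]; positivity

theorem eigMin_nonneg {x y z : ℝ} (hx : 0 ≤ x) (hz : 0 ≤ z) (h : y ^ 2 ≤ x * z) :
    0 ≤ eigMin x y z := by
  rw [eigMin, sub_nonneg, Real.sqrt_le_left (by positivity)]
  nlinarith

theorem eigMin_le_eigMax (x y z : ℝ) : eigMin x y z ≤ eigMax x y z := by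
  have := Real.sqrt_nonneg (((x - z) / 2) ^ 2 + y ^ 2)
  rw [eigMax, eigMin]; linarith

theorem eigMax_smul {c : ℝ} (hc : 0 ≤ c) (x y z : ℝ) :
    eigMax (c * x) (c * y) (c * z) = c * eigMax x y z := by
  have : ((c * x - c * z) / 2) ^ 2 + (c * y) ^ 2 = c ^ 2 * (((x - z) / 2) ^ 2 + y ^ 2) := by ring
  rw [eigMax, eigMax, this, Real.sqrt_mul (sq_nonneg c), Real.sqrt_sq hc]; ring

theorem eigMin_smul {c : ℝ} (hc : 0 ≤ c) (x y z : ℝ) :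
    eigMin (c * x) (c * y) (c * z) = c * eigMin x y z := by
  have : ((c * x - c * z) / 2) ^ 2 + (c * y) ^ 2 = c ^ 2 * (((x - z) / 2) ^ 2 + y ^ 2) := by ring
  rw [eigMin, eigMin, this, Real.sqrt_mul (sq_nonneg c), Real.sqrt_sq hc]; ring

theorem log_one_add_eig {x y z u : ℝ} (hx : 0 ≤ x) (hz : 0 ≤ z) (h : y ^ 2 ≤ x * z) (hu : 0 < u) :
    Real.log (1 + eigMax x y z * u) + Real.log (1 + eigMin x y z * u) =
      Real.log ((1 + x * u) * (1 + z * u) - (y * u) ^ 2) := by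
  have h1 := eigMax_nonneg y hx hz
  have h2 := eigMin_nonneg hx hz h
  rw [← Real.log_mul (by positivity) (by positivity)]
  congr 1
  linear_combination u * eigMax_add_eigMin x y z + u ^ 2 * eigMax_mul_eigMin x y z

/-- The excess of the `p`-th power trace of `!![x, y; y, z]` over that of its diagonal. -/
def traceExcess (p x y z : ℝ) : ℝ := eigMax x y z ^ p + eigMin x y z ^ p - x ^ p - z ^ p

theorem traceExcess_zero (p : ℝ) {x z : ℝ} : traceExcess p x 0 z = 0 := by
  have h : √(((x - z) / 2) ^ 2 + 0 ^ 2) = |(x - z) / 2| := by simp [Real.sqrt_sq_eq_abs]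
  rw [traceExcess, eigMax, eigMin, h]
  rcases abs_cases ((x - z) / 2) with ⟨h, -⟩ | ⟨h, -⟩ <;> rw [h] <;> ring_nf

theorem traceExcess_smul (p : ℝ) {c x y z : ℝ} (hc : 0 ≤ c) (hx : 0 ≤ x) (hz : 0 ≤ z)
    (h : y ^ 2 ≤ x * z) : traceExcess p (c * x) (c * y) (c * z) = c ^ p * traceExcess p x y z := by
  rw [traceExcess, eigMax_smul hc, eigMin_smul hc, Real.mul_rpow hc (eigMax_nonneg y hx hz),
    Real.mul_rpow hc (eigMin_nonneg hx hz h), Real.mul_rpow hc hx, Real.mul_rpow hc hz, traceExcess]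
  ring

/-- 1 - exp (-t) is concave, and log is concave and increasing. With t = log ((1 + x u) (1 + z u) /
u²) this function is minus the log-determinant excess of a 2 × 2 matrix with off-diagonal entry 1.
-/
theorem convexOn_neg_log_one_sub_exp_neg :
    ConvexOn ℝ (Ioi (0 : ℝ)) fun t => -Real.log (1 - Real.exp (-t)) := by
  have hlt {t : ℝ} (ht : 0 < t) : 0 < 1 - Real.exp (-t) := by
    have : Real.exp (-t) < 1 := Real.exp_lt_one_iff.2 (by linarith)
    linarith
  have hexp : ConcaveOn ℝ (Ioi (0 : ℝ)) fun t => 1 - Real.exp (-t) := by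
    refine ⟨convex_Ioi 0, fun x _ y _ a b ha hb hab => ?_⟩
    have := convexOn_exp.2 (mem_univ (-x)) (mem_univ (-y)) ha hb hab
    simp only [smul_eq_mul] at this ⊢
    rw [show -(a * x + b * y) = a * -x + b * -y by ring]
    nlinarith
  have hc : ConcaveOn ℝ (Ioi (0 : ℝ)) fun t => Real.log (1 - Real.exp (-t)) := by
    refine ⟨convex_Ioi 0, fun x hx y hy a b ha hb hab => ?_⟩
    have h1 := strictConcaveOn_log_Ioi.concaveOn.2 (hlt hx) (hlt hy) ha hb hab
    have h2 := hexp.2 hx hy ha hb hab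
    have h3 : 0 < a • (1 - Real.exp (-x)) + b • (1 - Real.exp (-y)) :=
      convex_Ioi (0 : ℝ) (hlt hx) (hlt hy) ha hb hab
    exact h1.trans (Real.log_le_log h3 h2)
  exact hc.neg

theorem neg_log_one_sub_exp_neg_anti {s t : ℝ} (hs : 0 < s) (hst : s ≤ t) :
    -Real.log (1 - Real.exp (-t)) ≤ -Real.log (1 - Real.exp (-s)) := by
  have h1 : Real.exp (-s) < 1 := Real.exp_lt_one_iff.2 (by linarith)
  have h2 : Real.exp (-t) ≤ Real.exp (-s) := Real.exp_le_exp.2 (by linarith)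
  exact neg_le_neg (Real.log_le_log (by linarith) (by linarith))

/-- Each matrix feeds four numbers into `sum_mul_rpow_nonneg`: its eigenvalues with sign +, its
diagonal entries with sign -. The linear condition is equality of traces, so only log-determinants
have to be compared. -/
theorem sum_mul_traceExcess_nonneg {ι : Type*} [Fintype ι] {p : ℝ} (hp1 : 1 < p) (hp2 : p < 2)
    {c x y z : ι → ℝ} (hx : ∀ i, 0 ≤ x i) (hz : ∀ i, 0 ≤ z i) (h : ∀ i, y i ^ 2 ≤ x i * z i)
    (hlog : ∀ u, 0 < u → ∑ i, c i * (Real.log ((1 + x i * u) * (1 + z i * u) - (y i * u) ^ 2)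
      - Real.log (1 + x i * u) - Real.log (1 + z i * u)) ≤ 0) :
    0 ≤ ∑ i, c i * traceExcess p (x i) (y i) (z i) := by
  have key := sum_mul_rpow_nonneg (ι := ι × Fin 4) hp1 hp2
    (w := fun j => c j.1 * (![1, 1, -1, -1] : Fin 4 → ℝ) j.2)
    (a := fun j => (![eigMax (x j.1) (y j.1) (z j.1), eigMin (x j.1) (y j.1) (z j.1), x j.1, z j.1] :
      Fin 4 → ℝ) j.2) (fun j => ?_) ?_ ?_
  · refine key.trans_eq ?_
    rw [Fintype.sum_prod_type]
    refine Finset.sum_congr rfl fun i _ => ?_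
    simp only [Fin.sum_univ_four, traceExcess, Matrix.cons_val]
    ring
  · obtain ⟨i, k⟩ := j
    fin_cases k
    · exact eigMax_nonneg _ (hx i) (hz i)
    · exact eigMin_nonneg (hx i) (hz i) (h i)
    · exact hx i
    · exact hz i
  · rw [Fintype.sum_prod_type]
    refine Finset.sum_eq_zero fun i _ => ?_
    simp only [Fin.sum_univ_four, Matrix.cons_val]
    linear_combination c i * eigMax_add_eigMin (x i) (y i) (z i)
  · intro u hu
    refine le_of_eq_of_le ?_ (hlog u hu)
    rw [Fintype.sum_prod_type]
    refine Finset.sum_congr rfl fun i _ => ?_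
    simp only [Fin.sum_univ_four, Matrix.cons_val]
    rw [← log_one_add_eig (hx i) (hz i) (h i) hu]
    ring

/-- Off-diagonal entry 1 makes the log-determinant excess a function of the single parameter log ((1
+ x u) (1 + z u) / u²), which is where convexity can be applied. -/
theorem log_ratio_eq {x z u : ℝ} (hx : 0 < x) (hz : 0 < z) (h : 1 ≤ x * z) (hu : 0 < u) :
    0 < Real.log (1 + x * u) + Real.log (1 + z * u) - 2 * Real.log u ∧
    Real.log ((1 + x * u) * (1 + z * u) - (1 * u) ^ 2)
      - Real.log (1 + x * u) - Real.log (1 + z * u) = Real.log (1 - Real.exp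
        (-(Real.log (1 + x * u) + Real.log (1 + z * u) - 2 * Real.log u))) := by
  have hxu : 0 < 1 + x * u := by positivity
  have hzu : 0 < 1 + z * u := by positivity
  have hlt : u ^ 2 < (1 + x * u) * (1 + z * u) := by nlinarith [mul_pos hx hu, mul_pos hz hu]
  have h1 : Real.log (1 + x * u) + Real.log (1 + z * u) - 2 * Real.log u =
      Real.log ((1 + x * u) * (1 + z * u) / u ^ 2) := by
    rw [Real.log_div (by positivity) (by positivity), Real.log_mul hxu.ne' hzu.ne', Real.log_pow]
    norm_num
  refine ⟨?_, ?_⟩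
  · rw [h1]
    exact Real.log_pos ((one_lt_div (by positivity)).2 hlt)
  · rw [h1, ← Real.log_inv, Real.exp_log (by positivity), sub_sub, ← Real.log_mul hxu.ne' hzu.ne',
      ← Real.log_div (by rw [one_mul]; linarith) (by positivity)]
    congr 1
    field_simp

/-- Jensen for the concave logarithm, then the power mean inequality Σ w ξ ≤ (Σ w ξ ^ p) ^ (1 / p) ≤
b. -/
theorem sum_mul_log_one_add_le {ι : Type*} [Fintype ι] {p : ℝ} (hp : 1 ≤ p) {w ξ : ι → ℝ}
    (hw : ∀ i, 0 ≤ w i) (hw1 : ∑ i, w i = 1) (hξ : ∀ i, 0 < ξ i) {b : ℝ} (hb : 0 ≤ b)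
    (h : ∑ i, w i * ξ i ^ p ≤ b ^ p) {u : ℝ} (hu : 0 < u) :
    ∑ i, w i * Real.log (1 + ξ i * u) ≤ Real.log (1 + b * u) := by
  have hp0 : 0 < p := by linarith
  have h1 : ∑ i, w i * ξ i ≤ b := by
    refine (Real.arith_mean_le_rpow_mean _ _ _ (fun i _ => hw i) hw1 (fun i _ => (hξ i).le) hp).trans
      ?_
    refine (Real.rpow_le_rpow (Finset.sum_nonneg fun i _ => mul_nonneg (hw i)
      (Real.rpow_nonneg (hξ i).le _)) h (by positivity)).trans_eq ?_
    rw [← Real.rpow_mul hb, mul_one_div_cancel hp0.ne', Real.rpow_one]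
  have h2 := strictConcaveOn_log_Ioi.concaveOn.le_map_sum (t := Finset.univ) (w := w)
    (p := fun i => 1 + ξ i * u) (fun i _ => hw i) hw1
    (fun i _ => by have := hξ i; exact mem_Ioi.2 (by positivity))
  simp only [smul_eq_mul] at h2
  have h3 : ∑ i, w i * (1 + ξ i * u) = 1 + (∑ i, w i * ξ i) * u := by
    simp only [mul_add, Finset.sum_add_distrib, mul_one, hw1, ← mul_assoc, ← Finset.sum_mul]
  rw [h3] at h2
  have h4 : 0 ≤ ∑ i, w i * ξ i := Finset.sum_nonneg fun i _ => mul_nonneg (hw i) (hξ i).le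
  refine h2.trans (Real.log_le_log (by positivity) ?_)
  gcongr

/-- The matrix with diagonal a, b enters with weight -1, as the index `none`. Let tᵢ and T be the
parameters of `log_ratio_eq`. Concavity bounds Σ wᵢ log (1 - exp (-tᵢ)) by the value at Σ wᵢ tᵢ, and
Σ wᵢ tᵢ ≤ T by `sum_mul_log_one_add_le`, so monotonicity concludes. -/
theorem traceExcess_le_weighted_sum {ι : Type*} [Fintype ι] {p : ℝ} (hp1 : 1 < p) (hp2 : p < 2)
    {w ξ ζ : ι → ℝ} (hw : ∀ i, 0 ≤ w i) (hw1 : ∑ i, w i = 1) (hξ : ∀ i, 0 < ξ i)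
    (hζ : ∀ i, 0 < ζ i) (h : ∀ i, 1 ≤ ξ i * ζ i) {a b : ℝ} (ha : 0 < a) (hb : 0 < b)
    (hab : 1 ≤ a * b) (hξa : ∑ i, w i * ξ i ^ p ≤ a ^ p) (hζb : ∑ i, w i * ζ i ^ p ≤ b ^ p) :
    traceExcess p a 1 b ≤ ∑ i, w i * traceExcess p (ξ i) 1 (ζ i) := by
  have key := sum_mul_traceExcess_nonneg (ι := Option ι) hp1 hp2 (c := fun j => j.elim (-1) w)
    (x := fun j => j.elim a ξ) (y := fun _ => 1) (z := fun j => j.elim b ζ)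
    (by rintro (_ | i); exacts [ha.le, (hξ i).le]) (by rintro (_ | i); exacts [hb.le, (hζ i).le])
    (by rintro (_ | i); exacts [by simpa using hab, by simpa using h i]) ?_
  · rw [Fintype.sum_option] at key
    simp only [Option.elim] at key
    linarith
  intro u hu
  rw [Fintype.sum_option]
  simp only [Option.elim]
  rw [(log_ratio_eq ha hb hab hu).2]
  have h1 : ∀ i, 0 < Real.log (1 + ξ i * u) + Real.log (1 + ζ i * u) - 2 * Real.log u :=
    fun i => (log_ratio_eq (hξ i) (hζ i) (h i) hu).1
  rw [Finset.sum_congr rfl fun i _ => by rw [(log_ratio_eq (hξ i) (hζ i) (h i) hu).2]]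
  have h2 := convexOn_neg_log_one_sub_exp_neg.map_sum_le (t := Finset.univ) (w := w)
    (p := fun i => Real.log (1 + ξ i * u) + Real.log (1 + ζ i * u) - 2 * Real.log u)
    (fun i _ => hw i) hw1 (fun i _ => h1 i)
  simp only [smul_eq_mul, mul_neg, Finset.sum_neg_distrib] at h2
  have h3 : ∑ i, w i * (Real.log (1 + ξ i * u) + Real.log (1 + ζ i * u) - 2 * Real.log u) =
      ∑ i, w i * Real.log (1 + ξ i * u) + ∑ i, w i * Real.log (1 + ζ i * u) - 2 * Real.log u := by
    simp only [mul_sub, mul_add, Finset.sum_add_distrib, Finset.sum_sub_distrib, ← Finset.sum_mul,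
      hw1, one_mul]
  have h4 : 0 < ∑ i, w i * (Real.log (1 + ξ i * u) + Real.log (1 + ζ i * u) - 2 * Real.log u) :=
    (convex_Ioi (0 : ℝ)).sum_mem (t := Finset.univ) (fun i _ => hw i) hw1 (fun i _ => h1 i)
  have h5 := neg_log_one_sub_exp_neg_anti h4 (t := Real.log (1 + a * u) + Real.log (1 + b * u) -
    2 * Real.log u) (by
      rw [h3]
      linarith [sum_mul_log_one_add_le hp1.le hw hw1 hξ ha.le hξa hu,
        sum_mul_log_one_add_le hp1.le hw hw1 hζ hb.le hζb hu])
  linarith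

/-- Minkowski-type inequality: the trace excess is subadditive in the `p`-th powers of the
entries. -/
theorem traceExcess_le_sum {ι : Type*} [Fintype ι] {p : ℝ} (hp1 : 1 < p) (hp2 : p < 2)
    {x y z : ι → ℝ} (hx : ∀ i, 0 ≤ x i) (hy : ∀ i, 0 ≤ y i) (hz : ∀ i, 0 ≤ z i)
    (h : ∀ i, y i ^ 2 ≤ x i * z i) {a b c : ℝ} (ha : 0 ≤ a) (hb : 0 ≤ b) (hc : 0 ≤ c)
    (hac : b ^ 2 ≤ a * c) (hxa : a ^ p = ∑ i, x i ^ p) (hyb : b ^ p = ∑ i, y i ^ p)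
    (hzc : c ^ p = ∑ i, z i ^ p) :
    traceExcess p a b c ≤ ∑ i, traceExcess p (x i) (y i) (z i) := by
  have hp0 : p ≠ 0 := by linarith
  rcases hb.eq_or_lt with rfl | hb
  · rw [Real.zero_rpow hp0, eq_comm, Finset.sum_eq_zero_iff_of_nonneg
      fun i _ => Real.rpow_nonneg (hy i) _] at hyb
    have hy0 (i : ι) : y i = 0 := (Real.rpow_eq_zero (hy i) hp0).1 (hyb i (Finset.mem_univ i))
    simp only [hy0, traceExcess_zero, Finset.sum_const_zero, le_refl]
  have hac0 : 0 < a * c := lt_of_lt_of_le (by positivity) hac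
  have ha' : 0 < a := ha.lt_of_ne fun h0 => by rw [← h0, zero_mul] at hac0; exact hac0.false
  have hc' : 0 < c := hc.lt_of_ne fun h0 => by rw [← h0, mul_zero] at hac0; exact hac0.false
  have hbp : 0 < b ^ p := Real.rpow_pos_of_pos hb _
  -- Homogeneity of degree p normalizes every off-diagonal entry to 1, at the price of the weights
  -- `w`. Where `y i = 0` the weight vanishes, and the default 1 merely keeps the hypotheses ξ, ζ >
  -- 0 and ξ ζ ≥ 1.
  set ξ : ι → ℝ := fun i => if y i = 0 then 1 else x i / y i with hξ
  set ζ : ι → ℝ := fun i => if y i = 0 then 1 else z i / y i with hζ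
  set w : ι → ℝ := fun i => y i ^ p / b ^ p with hw
  have hpos (i : ι) (hi : y i ≠ 0) : 0 < y i ∧ 0 < x i ∧ 0 < z i := by
    have hyi : 0 < y i := (hy i).lt_of_ne' hi
    have hxz : 0 < x i * z i := lt_of_lt_of_le (by positivity) (h i)
    exact ⟨hyi, (hx i).lt_of_ne fun h0 => by rw [← h0, zero_mul] at hxz; exact hxz.false,
      (hz i).lt_of_ne fun h0 => by rw [← h0, mul_zero] at hxz; exact hxz.false⟩
  -- Only an inequality: indices with `y i = 0` count on the right but not on the left.
  have hbound {v : ι → ℝ} {d : ℝ} (hv : ∀ i, 0 ≤ v i) (hd : 0 ≤ d) (hvd : d ^ p = ∑ i, v i ^ p) :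
      ∑ i, w i * (if y i = 0 then 1 else v i / y i) ^ p ≤ (d / b) ^ p := by
    rw [Real.div_rpow hd hb.le, hvd, Finset.sum_div]
    refine Finset.sum_le_sum fun i _ => ?_
    simp only [hw]
    split_ifs with hi
    · rw [hi, Real.zero_rpow hp0, zero_div, zero_mul]
      exact div_nonneg (Real.rpow_nonneg (hv i) _) hbp.le
    · have := Real.rpow_pos_of_pos (hpos i hi).1 p
      rw [Real.div_rpow (hv i) (hy i)]
      apply le_of_eq
      field_simp
  have key := traceExcess_le_weighted_sum hp1 hp2 (w := w) (ξ := ξ) (ζ := ζ) (a := a / b)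
    (b := c / b) (fun i => div_nonneg (Real.rpow_nonneg (hy i) _) hbp.le)
    (by rw [← Finset.sum_div, ← hyb, div_self hbp.ne'])
    (fun i => by
      simp only [hξ]
      split_ifs with hi
      exacts [one_pos, div_pos (hpos i hi).2.1 (hpos i hi).1])
    (fun i => by
      simp only [hζ]
      split_ifs with hi
      exacts [one_pos, div_pos (hpos i hi).2.2 (hpos i hi).1])
    (fun i => by
      simp only [hξ, hζ]
      split_ifs with hi
      · simp
      · rw [div_mul_div_comm, one_le_div (mul_pos (hpos i hi).1 (hpos i hi).1), ← sq]
        exact h i)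
    (div_pos ha' hb) (div_pos hc' hb)
    (by rw [div_mul_div_comm, one_le_div (by positivity), ← sq]; exact hac)
    (hbound hx ha hxa) (hbound hz hc hzc)
  have h1 : traceExcess p a b c = b ^ p * traceExcess p (a / b) 1 (c / b) := by
    rw [← traceExcess_smul p hb.le (by positivity) (by positivity) (by
      rw [div_mul_div_comm, one_pow, one_le_div (by positivity), ← sq]; exact hac),
      mul_div_cancel₀ _ hb.ne', mul_div_cancel₀ _ hb.ne', mul_one]
  rw [h1]
  refine (mul_le_mul_of_nonneg_left key hbp.le).trans_eq ?_
  rw [Finset.mul_sum]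
  refine Finset.sum_congr rfl fun i _ => ?_
  simp only [hw, hξ, hζ]
  split_ifs with hi
  · rw [hi, traceExcess_zero, Real.zero_rpow hp0]; simp
  · obtain ⟨h2, h3, h4⟩ := hpos i hi
    rw [← mul_assoc, mul_div_cancel₀ _ hbp.ne', ← traceExcess_smul p (hy i) (by positivity)
      (by positivity) (by
        rw [div_mul_div_comm, one_pow, one_le_div (by positivity), ← sq]; exact h i),
      mul_div_cancel₀ _ hi, mul_div_cancel₀ _ hi, mul_one]

end TwoByTwo

/-! ### Hadamard and Hadamard–Fischer determinant inequalities -/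

section Determinants

variable {n : Type*} [Fintype n] [DecidableEq n]

theorem det_eq_ofReal {A : Mat n} (hA : A.IsHermitian) : A.det = (A.det.re : ℂ) := by
  rw [hA.det_eq_prod_eigenvalues]
  simp only [RCLike.ofReal_eq_complex_ofReal, ← Complex.ofReal_prod, Complex.ofReal_re]

theorem det_re_nonneg {A : Mat n} (hA : A.PosSemidef) : 0 ≤ A.det.re :=
  (Complex.nonneg_iff.1 hA.det_nonneg).1

theorem trace_re_eq_sum_eigenvalues {A : Mat n} (hA : A.IsHermitian) :
    A.trace.re = ∑ i, hA.eigenvalues i := by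
  rw [hA.trace_eq_sum_eigenvalues]
  simp

/-- **Hadamard's inequality** for positive semidefinite matrices. -/
theorem det_le_prod_diag {A : Mat n} (hA : A.PosSemidef) : A.det.re ≤ ∏ i, (A i i).re := by
  have hd (i : n) : 0 ≤ (A i i).re := (posSemidef_diag_re hA i).1
  by_cases h0 : ∃ i, (A i i).re = 0
  · obtain ⟨i, hi⟩ := h0
    rw [det_eq_zero_of_row_eq_zero i fun j => ?_]
    · exact Finset.prod_nonneg fun i _ => hd i
    · have := sq_norm_le_of_posSemidef hA i j
      rw [hi, zero_mul] at this
      exact norm_eq_zero.1 (pow_eq_zero_iff two_ne_zero |>.1 (le_antisymm this (sq_nonneg _)))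
  push Not at h0
  have hd' (i : n) : 0 < (A i i).re := (hd i).lt_of_ne' (h0 i)
  -- Rescaling to unit diagonal makes the eigenvalues average to 1; then λ ≤ exp (λ - 1) bounds
  -- their product by 1.
  set c : n → ℝ := fun i => (√(A i i).re)⁻¹ with hc
  have hcc (i : n) : c i * c i * (A i i).re = 1 := by
    simp only [hc]
    rw [← mul_inv, Real.mul_self_sqrt (hd i), inv_mul_cancel₀ (h0 i)]
  set B : Mat n := diagonal (fun i => (c i : ℂ)) * A * (diagonal (fun i => (c i : ℂ)))ᴴ with hB
  have hBpos : B.PosSemidef := hA.mul_mul_conjTranspose_same _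
  have hstar := star_diagonal_ofReal c
  rw [star_eq_conjTranspose] at hstar
  rw [hstar] at hB
  have hBdet : B.det.re * ∏ i, (A i i).re = A.det.re := by
    have h1 : B.det = ((∏ i, c i * c i : ℝ) : ℂ) * (A.det.re : ℂ) := by
      rw [hB, det_mul, det_mul, det_diagonal, ← det_eq_ofReal hA.1]
      push_cast
      rw [Finset.prod_mul_distrib]
      ring
    rw [h1, ← Complex.ofReal_mul, Complex.ofReal_re, mul_right_comm, ← Finset.prod_mul_distrib]
    simp only [hcc, Finset.prod_const_one, one_mul]
  have hBtr : ∑ i, (hBpos.1.eigenvalues i - 1) = 0 := by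
    rw [Finset.sum_sub_distrib, ← trace_re_eq_sum_eigenvalues hBpos.1, Matrix.trace,
      Complex.re_sum, sub_eq_zero]
    refine Finset.sum_congr rfl fun i _ => ?_
    rw [diag_apply, hB, mul_diagonal, diagonal_mul, (posSemidef_diag_re hA i).2, ← hcc i]
    norm_cast
    ring
  have hBle : B.det.re ≤ 1 := by
    rw [hBpos.1.det_eq_prod_eigenvalues]
    simp only [RCLike.ofReal_eq_complex_ofReal, ← Complex.ofReal_prod, Complex.ofReal_re]
    calc ∏ i, hBpos.1.eigenvalues i ≤ ∏ i, Real.exp (hBpos.1.eigenvalues i - 1) :=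
          Finset.prod_le_prod (fun i _ => hBpos.eigenvalues_nonneg i) fun i _ => by
            linarith [Real.add_one_le_exp (hBpos.1.eigenvalues i - 1)]
      _ = 1 := by rw [← Real.exp_sum, hBtr, Real.exp_zero]
  rw [← hBdet]
  exact mul_le_of_le_one_left (Finset.prod_nonneg fun i _ => hd i) hBle

/-- A positive definite matrix is diagonalized by congruence with a triangular matrix, whose pivots
are controlled by the diagonal entries. -/
theorem exists_triangular_congruence {k : ℕ} {Q : Mat (Fin k)} (hQ : Q.PosDef) :
    ∃ (R : Mat (Fin k)) (D : Fin k → ℝ), (∀ i j, i < j → R i j = 0) ∧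
      R * Q * Rᴴ = diagonal (fun i => (D i : ℂ)) ∧ (∀ i, 0 < D i) ∧ (∀ i, R i i ≠ 0) ∧
      R.det = ∏ i, R i i ∧ ∀ i, D i ≤ ‖R i i‖ ^ 2 * (Q i i).re := by
  let := LDL.invertibleLowerInv hQ
  set R := LDL.lowerInv hQ with hR
  have htri : ∀ i j, i < j → R i j = 0 := fun i j hij => LDL.lowerInv_triangular hQ hij
  have hbt : R.BlockTriangular OrderDual.toDual := fun i j hij => htri i j hij
  have hdet : R.det = ∏ i, R i i := det_of_isLowerTriangular R hbt
  have hdet0 : R.det ≠ 0 := (isUnit_iff_isUnit_det R).1 (isUnit_of_invertible R) |>.ne_zero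
  have hR0 (i : Fin k) : R i i ≠ 0 := by
    rw [hdet] at hdet0
    exact Finset.prod_ne_zero_iff.1 hdet0 i (Finset.mem_univ i)
  have hD := LDL.diag_eq_lowerInv_conj hQ
  rw [← hR] at hD
  have hpos : (R * Q * Rᴴ).PosDef :=
    (IsUnit.posDef_star_right_conjugate_iff (isUnit_of_invertible R)).2 hQ
  have hDi (i : Fin k) : LDL.diagEntries hQ i = (R * Q * Rᴴ) i i := by
    rw [← hD, LDL.diag, diagonal_apply_eq]
  have hDre (i : Fin k) : LDL.diagEntries hQ i = ((LDL.diagEntries hQ i).re : ℂ) := by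
    rw [hDi]; exact (posSemidef_diag_re hpos.posSemidef i).2
  have hDpos (i : Fin k) : 0 < (LDL.diagEntries hQ i).re := by
    have := hpos.diag_pos (i := i)
    rw [← hDi, Complex.pos_iff] at this
    exact this.1
  refine ⟨R, fun i => (LDL.diagEntries hQ i).re, htri, ?_, hDpos, hR0, hdet, fun i => ?_⟩
  · rw [← hD, LDL.diag]
    congr 1
    ext i
    exact hDre i
  -- With C = R⁻¹ triangular, Q i i = Σⱼ |C i j|² D j ≥ |C i i|² D i, and the diagonal entries of C
  -- are the inverses of those of R.
  · have hCt := blockTriangular_inv_of_blockTriangular hbt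
    set C := R⁻¹ with hC
    have hCR : C * R = 1 := nonsing_inv_mul R ((isUnit_iff_isUnit_det R).1 (isUnit_of_invertible R))
    have hCii : C i i * R i i = 1 := by
      have h1 := congrFun (congrFun hCR i) i
      rw [Matrix.mul_apply, one_apply_eq, Finset.sum_eq_single i] at h1
      · exact h1
      · intro j _ hj
        rcases lt_or_gt_of_ne hj with h | h
        · rw [htri j i h, mul_zero]
        · rw [show C i j = 0 from hCt h, zero_mul]
      · exact fun h => absurd (Finset.mem_univ i) h
    have hQC : Q = C * diagonal (fun i => ((LDL.diagEntries hQ i).re : ℂ)) * Cᴴ := by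
      have h1 : diagonal (fun i => ((LDL.diagEntries hQ i).re : ℂ)) = R * Q * Rᴴ := by
        rw [← hD, LDL.diag]
        congr 1
        ext i
        exact (hDre i).symm
      rw [h1]
      calc Q = (C * R) * Q * (C * R)ᴴ := by rw [hCR]; simp
        _ = _ := by rw [conjTranspose_mul]; simp only [Matrix.mul_assoc]
    have hQii : (Q i i).re = ∑ j, ‖C i j‖ ^ 2 * (LDL.diagEntries hQ j).re := by
      have : Q i i = ((∑ j, ‖C i j‖ ^ 2 * (LDL.diagEntries hQ j).re : ℝ) : ℂ) := by
        conv_lhs => rw [hQC]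
        rw [Matrix.mul_apply]
        push_cast
        refine Finset.sum_congr rfl fun j _ => ?_
        rw [mul_diagonal, conjTranspose_apply, Complex.star_def, ← Complex.mul_conj']
        ring
      rw [this, Complex.ofReal_re]
    have h2 : ‖C i i‖ ^ 2 * (LDL.diagEntries hQ i).re ≤ (Q i i).re := by
      rw [hQii]
      exact Finset.single_le_sum (f := fun j => ‖C i j‖ ^ 2 * (LDL.diagEntries hQ j).re)
        (fun j _ => mul_nonneg (sq_nonneg _) (hDpos j).le) (Finset.mem_univ i)
    have h3 : ‖R i i‖ ^ 2 * ‖C i i‖ ^ 2 = 1 := by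
      rw [← mul_pow, ← norm_mul, mul_comm, hCii, norm_one, one_pow]
    calc (LDL.diagEntries hQ i).re = ‖R i i‖ ^ 2 * (‖C i i‖ ^ 2 * (LDL.diagEntries hQ i).re) := by
          rw [← mul_assoc, h3, one_mul]
      _ ≤ _ := mul_le_mul_of_nonneg_left h2 (sq_nonneg _)

/-- A Hadamard–Fischer type inequality for positive definite block matrices with diagonal
off-diagonal blocks. -/
theorem det_fromBlocks_mul_prod_le {k : ℕ} {Q P : Mat (Fin k)} {l : Fin k → ℝ} (hQ : Q.PosDef)
    (hP : P.PosDef) (hT : (fromBlocks Q (diagonal fun i => (l i : ℂ)) (diagonal fun i => (l i : ℂ))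
      P).PosSemidef) :
    (fromBlocks Q (diagonal fun i => (l i : ℂ)) (diagonal fun i => (l i : ℂ)) P).det.re *
      ∏ i, (Q i i).re * (P i i).re ≤
    Q.det.re * P.det.re * ∏ i, ((Q i i).re * (P i i).re - l i ^ 2) := by
  obtain ⟨R, D, htri, hD, hDpos, hR0, hRdet, hDle⟩ := exists_triangular_congruence hQ
  have hPu := hP.isUnit
  let : Invertible P := hPu.invertible
  set Λ : Mat (Fin k) := diagonal fun i => (l i : ℂ) with hΛ
  have hΛs : Λᴴ = Λ := by rw [← star_eq_conjTranspose, hΛ, star_diagonal_ofReal]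
  -- Schur complement: the block determinant is det P · det S. The plan is to apply Hadamard's
  -- inequality to R S Rᴴ, in which the contribution of Q is already diagonal.
  set S := Q - Λ * P⁻¹ * Λ with hS
  have hSpos : S.PosSemidef := by
    have := (PosDef.fromBlocks₂₂ Q Λ hP).1 (by rw [hΛs]; exact hT)
    rwa [hΛs] at this
  have hTdet : (fromBlocks Q Λ Λ P).det.re = P.det.re * S.det.re := by
    rw [det_fromBlocks₂₂, invOf_eq_nonsing_inv, ← hS, det_eq_ofReal hP.1, det_eq_ofReal hSpos.1,
      ← Complex.ofReal_mul]
    simp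
  have hPpos (i : Fin k) : 0 < (P i i).re := (Complex.pos_iff.1 (hP.diag_pos (i := i))).1
  have hQpos (i : Fin k) : 0 < (Q i i).re := (Complex.pos_iff.1 (hQ.diag_pos (i := i))).1
  have hr (i : Fin k) : 0 < ‖R i i‖ ^ 2 := by have := norm_pos_iff.2 (hR0 i); positivity
  have hdetconj (A : Mat (Fin k)) (hA : A.IsHermitian) :
      (R * A * Rᴴ).det.re = A.det.re * ∏ i, ‖R i i‖ ^ 2 := by
    have : (R * A * Rᴴ).det = ((A.det.re * ∏ i, ‖R i i‖ ^ 2 : ℝ) : ℂ) := by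
      rw [det_mul, det_mul, det_conjTranspose, hRdet]
      push_cast
      rw [← det_eq_ofReal hA, mul_right_comm, Complex.star_def, Complex.mul_conj', norm_prod]
      push_cast
      rw [Finset.prod_pow]
      ring
    rw [this, Complex.ofReal_re]
  have hQdet : Q.det.re * ∏ i, ‖R i i‖ ^ 2 = ∏ i, D i := by
    rw [← hdetconj Q hQ.1, hD, det_diagonal, ← Complex.ofReal_prod, Complex.ofReal_re]
  have hSR := hSpos.mul_mul_conjTranspose_same R
  have hdiag (i : Fin k) : ((R * S * Rᴴ) i i).re ≤ D i - ‖R i i‖ ^ 2 * l i ^ 2 / (P i i).re := by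
    set B := R * Λ with hB
    have h1 : R * S * Rᴴ = diagonal (fun i => (D i : ℂ)) - B * P⁻¹ * Bᴴ := by
      rw [← hD, hS, hB, conjTranspose_mul, hΛs]
      simp only [Matrix.mul_sub, Matrix.sub_mul, Matrix.mul_assoc]
    -- This block matrix has zero Schur complement. Its 2 × 2 minor at i gives (B P⁻¹ Bᴴ) i i ≥ |B i
    -- i|² / P i i, and B i i = R i i · l i.
    have h2 : (fromBlocks (B * P⁻¹ * Bᴴ) B Bᴴ P).PosSemidef :=
      (PosDef.fromBlocks₂₂ _ B hP).2 (by rw [sub_self]; exact PosSemidef.zero)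
    have h3 := sq_norm_le_of_posSemidef h2 (Sum.inl i) (Sum.inr i)
    simp only [fromBlocks_apply₁₁, fromBlocks_apply₁₂, fromBlocks_apply₂₂] at h3
    have h4 : ‖B i i‖ ^ 2 = ‖R i i‖ ^ 2 * l i ^ 2 := by
      rw [hB, hΛ, mul_diagonal, norm_mul, mul_pow, Complex.norm_real, Real.norm_eq_abs, sq_abs]
    rw [h1, Matrix.sub_apply, diagonal_apply_eq, Complex.sub_re, Complex.ofReal_re, ← h4]
    have := (div_le_iff₀ (hPpos i)).2 h3
    linarith
  have hfac (i : Fin k) : 0 ≤ D i - ‖R i i‖ ^ 2 * l i ^ 2 / (P i i).re :=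
    (posSemidef_diag_re hSR i).1.trans (hdiag i)
  have hSle : S.det.re * ∏ i, ‖R i i‖ ^ 2 ≤
      ∏ i, (D i - ‖R i i‖ ^ 2 * l i ^ 2 / (P i i).re) := by
    rw [← hdetconj S hSpos.1]
    exact (det_le_prod_diag hSR).trans (Finset.prod_le_prod
      (fun i _ => (posSemidef_diag_re hSR i).1) fun i _ => hdiag i)
  have hprod : (∏ i, (D i - ‖R i i‖ ^ 2 * l i ^ 2 / (P i i).re)) * ∏ i, (Q i i).re * (P i i).re ≤
      (∏ i, D i) * ∏ i, ((Q i i).re * (P i i).re - l i ^ 2) := by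
    rw [← Finset.prod_mul_distrib, ← Finset.prod_mul_distrib]
    refine Finset.prod_le_prod (fun i _ => mul_nonneg (hfac i)
      (mul_nonneg (hQpos i).le (hPpos i).le)) fun i _ => ?_
    have h1 : ‖R i i‖ ^ 2 * l i ^ 2 / (P i i).re * ((Q i i).re * (P i i).re) =
        ‖R i i‖ ^ 2 * (Q i i).re * l i ^ 2 := by
      have := (hPpos i).ne'
      field_simp
    -- The bound D i ≤ |R i i|² Q i i turns the subtracted term into at least D i · l i², so that D
    -- i factors out.
    rw [sub_mul, h1]
    have := mul_le_mul_of_nonneg_right (hDle i) (sq_nonneg (l i))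
    linarith
  have hrp : 0 < ∏ i, ‖R i i‖ ^ 2 := Finset.prod_pos fun i _ => hr i
  have hQP : 0 ≤ ∏ i, (Q i i).re * (P i i).re :=
    Finset.prod_nonneg fun i _ => mul_nonneg (hQpos i).le (hPpos i).le
  have hfinal : S.det.re * (∏ i, (Q i i).re * (P i i).re) ≤
      Q.det.re * ∏ i, ((Q i i).re * (P i i).re - l i ^ 2) := by
    refine le_of_mul_le_mul_right ?_ hrp
    calc _ = (S.det.re * ∏ i, ‖R i i‖ ^ 2) * ∏ i, (Q i i).re * (P i i).re := by ring
      _ ≤ _ := (mul_le_mul_of_nonneg_right hSle hQP).trans hprod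
      _ = _ := by rw [← hQdet]; ring
  rw [hTdet]
  calc _ = P.det.re * (S.det.re * ∏ i, (Q i i).re * (P i i).re) := by ring
    _ ≤ P.det.re * (Q.det.re * ∏ i, ((Q i i).re * (P i i).re - l i ^ 2)) :=
        mul_le_mul_of_nonneg_left hfinal (det_re_nonneg hP.posSemidef)
    _ = _ := by ring

end Determinants

/-! ### King's inequality for 1 ≤ p ≤ 2 -/

section BlockNorms

/-- b / (b - L) decreases in b. This permits replacing diagonal entries by larger majorants in the
log-determinant comparison. -/
theorem log_sub_log_sub_anti {a b L : ℝ} (hL : 0 ≤ L) (ha : L < a) (hab : a ≤ b) :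
    Real.log b - Real.log (b - L) ≤ Real.log a - Real.log (a - L) := by
  rw [← Real.log_div (by linarith) (by linarith), ← Real.log_div (by linarith) (by linarith)]
  refine Real.log_le_log (div_pos (by linarith) (by linarith)) ?_
  rw [div_le_div_iff₀ (by linarith) (by linarith)]
  nlinarith

variable {n : Type*} [Fintype n] [DecidableEq n]

theorem posDef_one_add_smul {n : Type*} [DecidableEq n] {A : Mat n} (hA : A.PosSemidef) {u : ℝ} (hu : 0 < u) :
    (1 + (u : ℂ) • A).PosDef :=
  PosDef.one.add_posSemidef (hA.smul (by simpa using hu.le))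

theorem log_det_one_add_smul {A : Mat n} (hA : A.PosSemidef) {u : ℝ} (hu : 0 < u) :
    Real.log (1 + (u : ℂ) • A).det.re = ∑ i, Real.log (1 + hA.1.eigenvalues i * u) := by
  obtain ⟨U, hU, h⟩ := hA.1.exists_unitary_diagonal_complex
  have hdet : (1 + (u : ℂ) • A).det = ((∏ i, (1 + hA.1.eigenvalues i * u) : ℝ) : ℂ) := by
    have h1 : 1 + (u : ℂ) • A =
        U * (1 + (u : ℂ) • diagonal (fun i => (hA.1.eigenvalues i : ℂ))) * star U := by
      rw [Matrix.mul_add, Matrix.add_mul, Matrix.mul_one, (mem_unitaryGroup_iff).1 hU,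
        Matrix.mul_smul, Matrix.smul_mul, ← h]
    have h2 : (1 + (u : ℂ) • diagonal (fun i => (hA.1.eigenvalues i : ℂ))) =
        diagonal (fun i => ((1 + hA.1.eigenvalues i * u : ℝ) : ℂ)) := by
      rw [← diagonal_smul, ← diagonal_one, diagonal_add]
      congr 1
      ext i
      simp [mul_comm]
    rw [h1, det_mul_right_comm, (mem_unitaryGroup_iff).1 hU, Matrix.one_mul, h2, det_diagonal]
    push_cast
    rfl
  rw [hdet, Complex.ofReal_re, Real.log_prod]
  intro i _
  have := hA.eigenvalues_nonneg i
  positivity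

/-- The logarithm of `det_fromBlocks_mul_prod_le` applied to 1 + u M, followed by enlarging the
diagonal entries to x and z. -/
theorem sum_log_det_fromBlocks_le {k : ℕ} {X Z : Mat (Fin k)} {x y z : Fin k → ℝ}
    (hM : (fromBlocks X (diagonal fun i => (y i : ℂ)) (diagonal fun i => (y i : ℂ)) Z).PosSemidef)
    (hx : ∀ i, (X i i).re ≤ x i) (hz : ∀ i, (Z i i).re ≤ z i) {u : ℝ} (hu : 0 < u) :
    ∑ i, Real.log (1 + hM.1.eigenvalues i * u) -
      ∑ i, Real.log (1 + (posSemidef_block_left hM).1.eigenvalues i * u) -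
      ∑ i, Real.log (1 + (posSemidef_block_right hM).1.eigenvalues i * u) ≤
    ∑ i, (Real.log ((1 + x i * u) * (1 + z i * u) - (y i * u) ^ 2) - Real.log (1 + x i * u)
      - Real.log (1 + z i * u)) := by
  have hX := posSemidef_block_left hM
  have hZ := posSemidef_block_right hM
  have hQ := posDef_one_add_smul hX hu
  have hP := posDef_one_add_smul hZ hu
  have hT := posDef_one_add_smul hM hu
  rw [← log_det_one_add_smul hM hu, ← log_det_one_add_smul hX hu, ← log_det_one_add_smul hZ hu]
  have hblock : 1 + (u : ℂ) • fromBlocks X (diagonal fun i => (y i : ℂ))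
      (diagonal fun i => (y i : ℂ)) Z = fromBlocks (1 + (u : ℂ) • X)
        (diagonal fun i => ((y i * u : ℝ) : ℂ)) (diagonal fun i => ((y i * u : ℝ) : ℂ))
        (1 + (u : ℂ) • Z) := by
    rw [← fromBlocks_one, fromBlocks_smul, fromBlocks_add, ← diagonal_smul]
    have : (fun i => ((y i * u : ℝ) : ℂ)) = (u : ℂ) • fun i => (y i : ℂ) := by
      ext i; simp [mul_comm]
    rw [this]
    simp
  have hle := det_fromBlocks_mul_prod_le hQ hP (l := fun i => y i * u)
    (by rw [← hblock]; exact hT.posSemidef)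
  rw [← hblock] at hle
  have hqd (i : Fin k) : ((1 + (u : ℂ) • X) i i).re = 1 + (X i i).re * u := by
    simp [mul_comm]
  have hpd (i : Fin k) : ((1 + (u : ℂ) • Z) i i).re = 1 + (Z i i).re * u := by
    simp [mul_comm]
  simp only [hqd, hpd] at hle
  have hx0 (i : Fin k) : 0 ≤ (X i i).re := (posSemidef_diag_re hX i).1
  have hz0 (i : Fin k) : 0 ≤ (Z i i).re := (posSemidef_diag_re hZ i).1
  have hq0 (i : Fin k) : 0 < 1 + (X i i).re * u := by have := hx0 i; positivity
  have hp0 (i : Fin k) : 0 < 1 + (Z i i).re * u := by have := hz0 i; positivity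
  have hlt (i : Fin k) : (y i * u) ^ 2 < (1 + (X i i).re * u) * (1 + (Z i i).re * u) := by
    have h1 := mul_le_mul_of_nonneg_right (sq_le_of_posSemidef_fromBlocks hM i) (sq_nonneg u)
    nlinarith [mul_nonneg (hx0 i) hu.le, mul_nonneg (hz0 i) hu.le]
  have hdT : 0 < (1 + (u : ℂ) • fromBlocks X (diagonal fun i => (y i : ℂ))
      (diagonal fun i => (y i : ℂ)) Z).det.re := (Complex.pos_iff.1 hT.det_pos).1
  have hdQ : 0 < (1 + (u : ℂ) • X).det.re := (Complex.pos_iff.1 hQ.det_pos).1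
  have hdP : 0 < (1 + (u : ℂ) • Z).det.re := (Complex.pos_iff.1 hP.det_pos).1
  have hprod1 : 0 < ∏ i, (1 + (X i i).re * u) * (1 + (Z i i).re * u) :=
    Finset.prod_pos fun i _ => mul_pos (hq0 i) (hp0 i)
  have hprod2 : 0 < ∏ i, ((1 + (X i i).re * u) * (1 + (Z i i).re * u) - (y i * u) ^ 2) :=
    Finset.prod_pos fun i _ => sub_pos.2 (hlt i)
  have hlog := Real.log_le_log (mul_pos hdT hprod1) hle
  rw [Real.log_mul hdT.ne' hprod1.ne', Real.log_mul (mul_pos hdQ hdP).ne' hprod2.ne',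
    Real.log_mul hdQ.ne' hdP.ne', Real.log_prod fun i _ => (mul_pos (hq0 i) (hp0 i)).ne',
    Real.log_prod fun i _ => (sub_pos.2 (hlt i)).ne'] at hlog
  have hfin : ∑ i, (Real.log ((1 + (X i i).re * u) * (1 + (Z i i).re * u) - (y i * u) ^ 2) -
      Real.log ((1 + (X i i).re * u) * (1 + (Z i i).re * u))) ≤
      ∑ i, (Real.log ((1 + x i * u) * (1 + z i * u) - (y i * u) ^ 2) - Real.log (1 + x i * u)
      - Real.log (1 + z i * u)) := by
    refine Finset.sum_le_sum fun i _ => ?_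
    have h1 : 1 + (X i i).re * u ≤ 1 + x i * u := by gcongr; exact hx i
    have h2 : 1 + (Z i i).re * u ≤ 1 + z i * u := by gcongr; exact hz i
    rw [sub_sub, ← Real.log_mul ((hq0 i).trans_le h1).ne' ((hp0 i).trans_le h2).ne']
    have := log_sub_log_sub_anti (sq_nonneg (y i * u)) (hlt i)
      (mul_le_mul h1 h2 (hp0 i).le ((hq0 i).le.trans h1))
    linarith
  rw [Finset.sum_sub_distrib] at hfin
  linarith

theorem trace_fromBlocks_eq {n : Type*} [Fintype n] (X Y Y' Z : Mat n) :
    (fromBlocks X Y Y' Z).trace = X.trace + Z.trace := by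
  simp [Matrix.trace, Fintype.sum_sum_type]

theorem schattenNorm_two_sq (A : Mat n) : schattenNorm 2 A ^ (2 : ℝ) = ∑ i, ∑ j, ‖A i j‖ ^ 2 := by
  obtain ⟨U, hU, V, hV, d, hd, h⟩ := exists_svd_complex A
  rw [schattenNorm_rpow two_ne_zero hU hV hd h]
  have h1 : star A * A = V * diagonal (fun i => ((d i ^ 2 : ℝ) : ℂ)) * star V := by
    calc star A * A = V * (diagonal (fun i => (d i : ℂ)) * ((star U * U) *
          (diagonal (fun i => (d i : ℂ))))) * star V := by
          rw [h]; simp only [star_mul, star_star, star_diagonal_ofReal, Matrix.mul_assoc]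
      _ = _ := by
          rw [(mem_unitaryGroup_iff').1 hU, Matrix.one_mul, diagonal_mul_diagonal]
          simp only [sq, Complex.ofReal_mul]
  have h2 := congrArg Matrix.trace h1
  rw [trace_unitary_conj hV, trace_diagonal, Matrix.trace] at h2
  have h3 : ∑ i, (star A * A).diag i = ((∑ j, ∑ i, ‖A i j‖ ^ 2 : ℝ) : ℂ) := by
    push_cast
    refine Finset.sum_congr rfl fun j _ => ?_
    rw [diag_apply, Matrix.mul_apply]
    refine Finset.sum_congr rfl fun i _ => ?_
    rw [star_apply, Complex.star_def, Complex.conj_mul']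
  rw [h3, ← Complex.ofReal_sum] at h2
  have h4 := Complex.ofReal_injective h2
  rw [Finset.sum_comm] at h4
  simp only [Real.rpow_two]
  exact h4.symm

/-- **King's inequality** for `1 ≤ p ≤ 2`: replacing the blocks of a positive `2 × 2` block matrix by
their norms decreases the Schatten norm. -/
theorem eigMax_rpow_add_eigMin_rpow_le {k : ℕ} {p : ℝ} (hp1 : 1 ≤ p) (hp2 : p ≤ 2)
    {X Y Z : Mat (Fin k)} (hM : (fromBlocks X Y Yᴴ Z).PosSemidef) :
    eigMax (schattenNorm p X) (schattenNorm p Y) (schattenNorm p Z) ^ p +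
      eigMin (schattenNorm p X) (schattenNorm p Y) (schattenNorm p Z) ^ p ≤
      schattenNorm p (fromBlocks X Y Yᴴ Z) ^ p := by
  have hp0 : p ≠ 0 := by linarith
  have hX := posSemidef_block_left hM
  have hZ := posSemidef_block_right hM
  -- The integral representation needs 1 < p < 2. The endpoints are equalities: traces at p = 1,
  -- sums of squared moduli of entries at p = 2.
  rcases hp1.eq_or_lt with rfl | hp1'
  · have h1 := schattenNorm_rpow_posSemidef hp0 hM
    have h2 := schattenNorm_rpow_posSemidef hp0 hX
    have h3 := schattenNorm_rpow_posSemidef hp0 hZ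
    simp only [Real.rpow_one] at h1 h2 h3 ⊢
    rw [eigMax_add_eigMin, h1, h2, h3, ← trace_re_eq_sum_eigenvalues, ← trace_re_eq_sum_eigenvalues,
      ← trace_re_eq_sum_eigenvalues, trace_fromBlocks_eq, Complex.add_re]
  rcases hp2.eq_or_lt with rfl | hp2'
  · have hs (a b c : ℝ) : eigMax a b c ^ (2 : ℝ) + eigMin a b c ^ (2 : ℝ) =
        a ^ (2 : ℝ) + b ^ (2 : ℝ) + (b ^ (2 : ℝ) + c ^ (2 : ℝ)) := by
      simp only [Real.rpow_two]
      linear_combination (eigMax a b c + eigMin a b c + a + c) * eigMax_add_eigMin a b c -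
        2 * eigMax_mul_eigMin a b c
    have hY : schattenNorm 2 Y ^ (2 : ℝ) = ∑ i, ∑ j, ‖Yᴴ i j‖ ^ 2 := by
      rw [← schattenNorm_two_sq, ← star_eq_conjTranspose, schattenNorm_star]
    rw [hs]
    conv_lhs => enter [2, 1]; rw [hY]
    rw [schattenNorm_two_sq, schattenNorm_two_sq, schattenNorm_two_sq, schattenNorm_two_sq]
    simp only [Fintype.sum_sum_type, fromBlocks_apply₁₁, fromBlocks_apply₁₂, fromBlocks_apply₂₁,
      fromBlocks_apply₂₂, Finset.sum_add_distrib]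
    linarith
  obtain ⟨X', Z', y, hy, hM', hX', hZ', hY, hMM'⟩ := exists_diagonal_offDiagonal hM
  have hXp := posSemidef_block_left hM'
  have hZp := posSemidef_block_right hM'
  obtain ⟨x, hx0, hx, hxs⟩ := exists_diag_majorant hp1 hXp
  obtain ⟨z, hz0, hz, hzs⟩ := exists_diag_majorant hp1 hZp
  have hyxz (i : Fin k) : y i ^ 2 ≤ x i * z i := (sq_le_of_posSemidef_fromBlocks hM' i).trans
    (mul_le_mul (hx i) (hz i) (posSemidef_diag_re hZp i).1 (hx0 i))
  -- Weight +1 on the eigenvalues of the block matrix, -1 on those of its diagonal blocks, and minus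
  -- the four-term excess of each scalar matrix. The conclusion is that the excess of the block
  -- matrix is at least the sum of the scalar excesses.
  have key := sum_mul_rpow_nonneg
    (ι := ((Fin k ⊕ Fin k) ⊕ (Fin k ⊕ Fin k)) ⊕ Fin k × Fin 4) hp1' hp2'
    (w := Sum.elim (Sum.elim (fun _ => 1) (fun _ => -1))
      fun j => -(![1, 1, -1, -1] : Fin 4 → ℝ) j.2)
    (a := Sum.elim (Sum.elim hM'.1.eigenvalues (Sum.elim hXp.1.eigenvalues hZp.1.eigenvalues))
      fun j => (![eigMax (x j.1) (y j.1) (z j.1), eigMin (x j.1) (y j.1) (z j.1), x j.1, z j.1] :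
        Fin 4 → ℝ) j.2) ?_ ?_ ?_
  · simp only [Fintype.sum_sum_type, Sum.elim_inl, Sum.elim_inr, Fintype.sum_prod_type,
      Fin.sum_univ_four, Matrix.cons_val, one_mul, neg_mul, Finset.sum_add_distrib,
      Finset.sum_neg_distrib] at key
    have h1 := schattenNorm_rpow_posSemidef hp0 hM'
    have h2 := schattenNorm_rpow_posSemidef hp0 hXp
    have h3 := schattenNorm_rpow_posSemidef hp0 hZp
    rw [Fintype.sum_sum_type] at h1
    -- The majorants have exactly the p-norms of the diagonal blocks, so the merged matrix is the
    -- matrix of norms and the subtracted diagonal powers agree on both sides.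
    have h4 := traceExcess_le_sum hp1' hp2' hx0 hy hz0 hyxz (schattenNorm_nonneg p X)
      (schattenNorm_nonneg p Y) (schattenNorm_nonneg p Z) (schattenNorm_offDiagonal_sq_le hp1 hM)
      (by rw [hxs, hX']) (hY p hp0) (by rw [hzs, hZ'])
    simp only [traceExcess, Finset.sum_sub_distrib, Finset.sum_add_distrib] at h4
    rw [hX'] at h2 hxs
    rw [hZ'] at h3 hzs
    rw [hMM'] at h1
    linarith
  · rintro ((i | i | i) | ⟨i, j⟩)
    · exact hM'.eigenvalues_nonneg _
    · exact hXp.eigenvalues_nonneg _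
    · exact hZp.eigenvalues_nonneg _
    · fin_cases j
      · exact eigMax_nonneg _ (hx0 i) (hz0 i)
      · exact eigMin_nonneg (hx0 i) (hz0 i) (hyxz i)
      · exact hx0 i
      · exact hz0 i
  · have h1 := trace_re_eq_sum_eigenvalues hM'.1
    rw [trace_fromBlocks_eq, Complex.add_re, trace_re_eq_sum_eigenvalues hXp.1,
      trace_re_eq_sum_eigenvalues hZp.1] at h1
    have h2 : ∑ j : Fin k × Fin 4, -(![1, 1, -1, -1] : Fin 4 → ℝ) j.2 *
        (![eigMax (x j.1) (y j.1) (z j.1), eigMin (x j.1) (y j.1) (z j.1), x j.1, z j.1] :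
          Fin 4 → ℝ) j.2 = 0 := by
      rw [Fintype.sum_prod_type]
      refine Finset.sum_eq_zero fun i _ => ?_
      simp only [Fin.sum_univ_four, Matrix.cons_val]
      linear_combination -eigMax_add_eigMin (x i) (y i) (z i)
    rw [Fintype.sum_sum_type, Fintype.sum_sum_type]
    simp only [Sum.elim_inl, Sum.elim_inr]
    rw [h2, ← Finset.mul_sum, ← Finset.mul_sum, ← h1, Fintype.sum_sum_type]
    simp only [Sum.elim_inl, Sum.elim_inr]
    ring
  · intro u hu
    have h1 := sum_log_det_fromBlocks_le hM' hx hz hu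
    have h2 : ∑ j : Fin k × Fin 4, -(![1, 1, -1, -1] : Fin 4 → ℝ) j.2 * Real.log (1 +
        (![eigMax (x j.1) (y j.1) (z j.1), eigMin (x j.1) (y j.1) (z j.1), x j.1, z j.1] :
          Fin 4 → ℝ) j.2 * u) = -∑ i, (Real.log ((1 + x i * u) * (1 + z i * u) - (y i * u) ^ 2)
            - Real.log (1 + x i * u) - Real.log (1 + z i * u)) := by
      rw [Fintype.sum_prod_type, ← Finset.sum_neg_distrib]
      refine Finset.sum_congr rfl fun i _ => ?_
      simp only [Fin.sum_univ_four, Matrix.cons_val]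
      rw [← log_one_add_eig (hx0 i) (hz0 i) (hyxz i) hu]
      ring
    rw [Fintype.sum_sum_type, Fintype.sum_sum_type]
    simp only [Sum.elim_inl, Sum.elim_inr]
    rw [h2, ← Finset.mul_sum, ← Finset.mul_sum, Fintype.sum_sum_type (α₁ := Fin k)
      (f := fun j => Real.log (1 + Sum.elim hXp.1.eigenvalues hZp.1.eigenvalues j * u))]
    simp only [Sum.elim_inl, Sum.elim_inr]
    linarith

end BlockNorms

/-! ### Monotonicity of 2 × 2 norms, and King's inequality for q ≥ 2 -/

section Hermitian2

/-- The Hermitian `2 × 2` matrix with real diagonal entries `x`, `z` and off-diagonal entry `w`. -/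
def herm2 (x : ℝ) (w : ℂ) (z : ℝ) : Mat (Fin 2) := !![(x : ℂ), w; star w, (z : ℂ)]

theorem isHermitian_herm2 (x : ℝ) (w : ℂ) (z : ℝ) : (herm2 x w z).IsHermitian := by
  ext i j
  fin_cases i <;> fin_cases j <;> simp [herm2]

/-- Trace and determinant fix the eigenvalues only as an unordered pair, hence the symmetric sum
over an arbitrary f. -/
theorem sum_eigenvalues_herm2 (x : ℝ) (w : ℂ) (z : ℝ) (f : ℝ → ℝ) :
    ∑ i, f ((isHermitian_herm2 x w z).eigenvalues i) = f (eigMax x ‖w‖ z) + f (eigMin x ‖w‖ z) := by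
  set e := (isHermitian_herm2 x w z).eigenvalues with he
  have hs : e 0 + e 1 = x + z := by
    have := trace_re_eq_sum_eigenvalues (isHermitian_herm2 x w z)
    rw [Fin.sum_univ_two, trace_fin_two] at this
    have h2 : (herm2 x w z 0 0 + herm2 x w z 1 1).re = x + z := by simp [herm2]
    rw [← h2, this]
  have hp : e 0 * e 1 = x * z - ‖w‖ ^ 2 := by
    have h1 := (isHermitian_herm2 x w z).det_eq_prod_eigenvalues
    rw [Fin.prod_univ_two, det_fin_two] at h1
    simp only [herm2, of_apply, cons_val', cons_val_zero, cons_val_one,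
      cons_val_fin_one, Complex.star_def, Complex.mul_conj'] at h1
    have h2 : ((x * z - ‖w‖ ^ 2 : ℝ) : ℂ) = ((e 0 * e 1 : ℝ) : ℂ) := by
      push_cast
      exact h1
    exact (Complex.ofReal_injective h2).symm
  have hs' := eigMax_add_eigMin x ‖w‖ z
  have hp' := eigMax_mul_eigMin x ‖w‖ z
  have hfac : (e 0 - eigMax x ‖w‖ z) * (e 0 - eigMin x ‖w‖ z) = 0 := by
    linear_combination e 0 * hs - hp - e 0 * hs' + hp'
  rw [Fin.sum_univ_two]
  rcases mul_eq_zero.1 hfac with h | h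
  · have h0 : e 0 = eigMax x ‖w‖ z := by linarith
    have h1 : e 1 = eigMin x ‖w‖ z := by linarith
    rw [h0, h1]
  · have h0 : e 0 = eigMin x ‖w‖ z := by linarith
    have h1 : e 1 = eigMax x ‖w‖ z := by linarith
    rw [h0, h1, add_comm]

theorem posSemidef_herm2 {x z : ℝ} {w : ℂ} (hx : 0 ≤ x) (hz : 0 ≤ z) (h : ‖w‖ ^ 2 ≤ x * z) :
    (herm2 x w z).PosSemidef := by
  rw [(isHermitian_herm2 x w z).posSemidef_iff_eigenvalues_nonneg]
  -- This f counts negative eigenvalues.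
  have h1 := sum_eigenvalues_herm2 x w z (fun t => if 0 ≤ t then 0 else 1)
  simp only [if_pos (eigMax_nonneg ‖w‖ hx hz), if_pos (eigMin_nonneg hx hz h), add_zero] at h1
  rw [Finset.sum_eq_zero_iff_of_nonneg (fun i _ => by split_ifs <;> norm_num)] at h1
  intro i
  by_contra hi
  have := h1 i (Finset.mem_univ i)
  rw [if_neg (by simpa using hi)] at this
  exact one_ne_zero this

theorem schattenNorm_herm2_rpow {p : ℝ} (hp : p ≠ 0) {x z : ℝ} {w : ℂ}
    (h : (herm2 x w z).PosSemidef) :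
    schattenNorm p (herm2 x w z) ^ p = eigMax x ‖w‖ z ^ p + eigMin x ‖w‖ z ^ p := by
  rw [schattenNorm_rpow_posSemidef hp h]
  exact sum_eigenvalues_herm2 x w z (fun t => t ^ p)

theorem herm2_entries {x z : ℝ} {w : ℂ} (h : (herm2 x w z).PosSemidef) :
    0 ≤ x ∧ 0 ≤ z ∧ ‖w‖ ^ 2 ≤ x * z := by
  have h0 := (posSemidef_diag_re h 0).1
  have h1 := (posSemidef_diag_re h 1).1
  have h2 := sq_norm_le_of_posSemidef h 0 1
  simp only [herm2, of_apply, cons_val', cons_val_zero, cons_val_one, cons_val_fin_one,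
    Complex.ofReal_re] at h0 h1 h2
  exact ⟨h0, h1, h2⟩

theorem sqrt_sq_add_le (s t y : ℝ) : √(s ^ 2 + y ^ 2) ≤ √(t ^ 2 + y ^ 2) + |s - t| := by
  have h1 := Real.sq_sqrt (by positivity : 0 ≤ t ^ 2 + y ^ 2)
  have h2 : |t| ≤ √(t ^ 2 + y ^ 2) := Real.abs_le_sqrt (by nlinarith [sq_nonneg y])
  have h3 : t * (s - t) ≤ |t| * |s - t| := by rw [← abs_mul]; exact le_abs_self _
  have h4 := mul_le_mul_of_nonneg_right h2 (abs_nonneg (s - t))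
  refine Real.sqrt_le_iff.2 ⟨by positivity, ?_⟩
  nlinarith [sq_abs (s - t)]

/-- The square root is 1-Lipschitz in (x - z) / 2, so its change is at most the increase of (x + z)
/ 2. -/
theorem eig_mono_diag {x x' y z z' : ℝ} (hx : x ≤ x') (hz : z ≤ z') :
    eigMax x y z ≤ eigMax x' y z' ∧ eigMin x y z ≤ eigMin x' y z' := by
  have h1 := sqrt_sq_add_le ((x - z) / 2) ((x' - z') / 2) y
  have h2 := sqrt_sq_add_le ((x' - z') / 2) ((x - z) / 2) y
  have h3 : |(x - z) / 2 - (x' - z') / 2| ≤ (x' - x) / 2 + (z' - z) / 2 :=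
    abs_le.2 ⟨by linarith, by linarith⟩
  rw [abs_sub_comm] at h2
  simp only [eigMax, eigMin]
  exact ⟨by linarith, by linarith⟩

/-- Spreading two numbers with fixed sum increases the sum of their `p`-th powers. -/
theorem rpow_add_rpow_le_of_spread {p : ℝ} (hp : 1 ≤ p) {a b c d : ℝ} (hd : 0 ≤ d) (hdb : d ≤ b)
    (hba : b ≤ a) (h : a + b = c + d) : a ^ p + b ^ p ≤ c ^ p + d ^ p := by
  rcases (show d ≤ c by linarith).eq_or_lt with hcd | hcd
  · have h1 : b = d := by linarith
    have h2 : a = c := by linarith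
    rw [h1, h2]
  have hconv := convexOn_rpow hp
  have hc : 0 ≤ c := by linarith
  have hcd' : 0 < c - d := by linarith
  -- Chosen so that a = t c + (1 - t) d; the equal sums force b = (1 - t) c + t d. Adding the two
  -- convexity inequalities concludes.
  set t := (a - d) / (c - d) with ht
  have ht0 : 0 ≤ t := div_nonneg (by linarith) hcd'.le
  have ht1 : 0 ≤ 1 - t := by
    rw [sub_nonneg, ht, div_le_one hcd']; linarith
  have htm : t * (c - d) = a - d := div_mul_cancel₀ _ hcd'.ne'
  have h1 := hconv.2 (Set.mem_Ici.2 hc) (Set.mem_Ici.2 hd) ht0 ht1 (by ring)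
  have h2 := hconv.2 (Set.mem_Ici.2 hc) (Set.mem_Ici.2 hd) ht1 ht0 (by ring)
  simp only [smul_eq_mul] at h1 h2
  rw [show t * c + (1 - t) * d = a by linarith] at h1
  rw [show (1 - t) * c + t * d = b by linarith] at h2
  linarith

theorem eigMax_le_of_abs_le {x y y' z : ℝ} (hy : 0 ≤ y) (hyy : y ≤ y') :
    eigMax x y z ≤ eigMax x y' z := by
  simp only [eigMax]
  gcongr

/-- The Schatten norm of a positive `2 × 2` matrix is monotone in the moduli of its entries. -/
theorem schattenNorm_herm2_mono {p : ℝ} (hp : 1 ≤ p) {x x' z z' : ℝ} {w w' : ℂ}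
    (h : (herm2 x w z).PosSemidef) (h' : (herm2 x' w' z').PosSemidef) (hx : x ≤ x')
    (hw : ‖w‖ ≤ ‖w'‖) (hz : z ≤ z') :
    schattenNorm p (herm2 x w z) ≤ schattenNorm p (herm2 x' w' z') := by
  have hp0 : 0 < p := by linarith
  refine (Real.rpow_le_rpow_iff (schattenNorm_nonneg _ _) (schattenNorm_nonneg _ _) hp0).1 ?_
  rw [schattenNorm_herm2_rpow hp0.ne' h, schattenNorm_herm2_rpow hp0.ne' h']
  obtain ⟨h1, h2, h3⟩ := herm2_entries h
  obtain ⟨h1', h2', h3'⟩ := herm2_entries h'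
  have hw2 : ‖w‖ ^ 2 ≤ x' * z' := (pow_le_pow_left₀ (norm_nonneg _) hw 2).trans h3'
  obtain ⟨hM, hm⟩ := eig_mono_diag (y := ‖w‖) hx hz
  -- Raising the diagonal raises both eigenvalues; raising the off-diagonal modulus then keeps the
  -- trace and spreads them.
  calc _ ≤ eigMax x' ‖w‖ z' ^ p + eigMin x' ‖w‖ z' ^ p :=
        add_le_add (Real.rpow_le_rpow (eigMax_nonneg _ h1 h2) hM hp0.le)
          (Real.rpow_le_rpow (eigMin_nonneg h1 h2 h3) hm hp0.le)
    _ ≤ _ := by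
        have h4 := eigMax_le_of_abs_le (x := x') (z := z') (norm_nonneg w) hw
        have h5 := eigMax_add_eigMin x' ‖w‖ z'
        have h6 := eigMax_add_eigMin x' ‖w'‖ z'
        exact rpow_add_rpow_le_of_spread hp (eigMin_nonneg h1' h2' h3') (by linarith)
          (eigMin_le_eigMax _ _ _) (by linarith)

theorem schattenNorm_herm2_congr {p : ℝ} (hp : 1 ≤ p) {x z : ℝ} {w w' : ℂ}
    (h : (herm2 x w z).PosSemidef) (hw : ‖w‖ = ‖w'‖) :
    schattenNorm p (herm2 x w z) = schattenNorm p (herm2 x w' z) := by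
  have h' : (herm2 x w' z).PosSemidef := by
    obtain ⟨h1, h2, h3⟩ := herm2_entries h
    exact posSemidef_herm2 h1 h2 (hw ▸ h3)
  exact le_antisymm (schattenNorm_herm2_mono hp h h' le_rfl hw.le le_rfl)
    (schattenNorm_herm2_mono hp h' h le_rfl hw.ge le_rfl)

theorem posSemidef_herm2_schattenNorm {n : Type*} [Fintype n] [DecidableEq n] {p : ℝ} (hp : 1 ≤ p)
    {X Y Z : Mat n} (hM : (fromBlocks X Y Yᴴ Z).PosSemidef) :
    (herm2 (schattenNorm p X) (schattenNorm p Y : ℝ) (schattenNorm p Z)).PosSemidef :=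
  posSemidef_herm2 (schattenNorm_nonneg _ _) (schattenNorm_nonneg _ _) (by
    rw [Complex.norm_real, Real.norm_of_nonneg (schattenNorm_nonneg _ _)]
    exact schattenNorm_offDiagonal_sq_le hp hM)

theorem schattenNorm_herm2_le {k : ℕ} {p : ℝ} (hp1 : 1 ≤ p) (hp2 : p ≤ 2)
    {X Y Z : Mat (Fin k)} (hM : (fromBlocks X Y Yᴴ Z).PosSemidef) :
    schattenNorm p (herm2 (schattenNorm p X) (schattenNorm p Y : ℝ) (schattenNorm p Z)) ≤
      schattenNorm p (fromBlocks X Y Yᴴ Z) := by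
  have hp0 : 0 < p := by linarith
  refine (Real.rpow_le_rpow_iff (schattenNorm_nonneg _ _) (schattenNorm_nonneg _ _) hp0).1 ?_
  rw [schattenNorm_herm2_rpow hp0.ne' (posSemidef_herm2_schattenNorm hp1 hM), Complex.norm_real,
    Real.norm_of_nonneg (schattenNorm_nonneg _ _)]
  exact eigMax_rpow_add_eigMin_rpow_le hp1 hp2 hM

/-- **King's inequality** for `q ≥ 2`: replacing the blocks of a positive `2 × 2` block matrix by
their norms increases the Schatten norm. -/
theorem schattenNorm_le_herm2 {k : ℕ} {q : ℝ} (hq : 2 ≤ q) {X Y Z : Mat (Fin k)}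
    (hM : (fromBlocks X Y Yᴴ Z).PosSemidef) :
    schattenNorm q (fromBlocks X Y Yᴴ Z) ≤
      schattenNorm q (herm2 (schattenNorm q X) (schattenNorm q Y : ℝ) (schattenNorm q Z)) := by
  set M := fromBlocks X Y Yᴴ Z with hMdef
  set r := q.conjExponent with hr
  have hqr : q.HolderConjugate r := Real.HolderConjugate.conjExponent (by linarith)
  have hr1 : 1 ≤ r := hqr.symm.lt.le
  have hr2 : r ≤ 2 := by
    rw [hr, Real.conjExponent, div_le_iff₀ (by linarith)]; linarith
  by_cases h0 : M = 0
  · rw [h0, schattenNorm_zero (by linarith)]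
    exact schattenNorm_nonneg _ _
  have hpos := schattenNorm_pos (by linarith : 0 < q) h0
  -- Duality: Hölder on each block of the pairing with the positive dual B gives the trace of a
  -- product of two 2 × 2 norm matrices. Hölder again, and the case r ≤ 2 for B, bring back the norm
  -- of B, which cancels.
  obtain ⟨B, hB1, hB2, hB3⟩ := exists_dual hqr M
  have hBpos := hB3 hM
  set B₁ := B.toBlocks₁₁
  set B₂ := B.toBlocks₁₂
  set B₃ := B.toBlocks₂₂
  have hBblock : B = fromBlocks B₁ B₂ B₂ᴴ B₃ := by
    have h1 := (fromBlocks_toBlocks B).symm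
    have h2 := hBpos.1
    rw [h1, isHermitian_fromBlocks_iff] at h2
    rw [h2.2.1]
    exact h1
  rw [hBblock] at hBpos
  have h1 : schattenNorm q M ^ q ≤ schattenNorm q X * schattenNorm r B₁ +
      schattenNorm q Y * schattenNorm r B₂ + (schattenNorm q Y * schattenNorm r B₂ +
      schattenNorm q Z * schattenNorm r B₃) := by
    have h2 : schattenNorm q M ^ q = ‖(M * B).trace‖ := by
      rw [hB1, Complex.norm_real, Real.norm_of_nonneg (Real.rpow_nonneg hpos.le _)]
    have h3 : (M * B).trace = (X * B₁).trace + (Y * B₂ᴴ).trace +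
        ((Yᴴ * B₂).trace + (Z * B₃).trace) := by
      rw [hMdef, hBblock, fromBlocks_multiply, trace_fromBlocks_eq, trace_add, trace_add]
    have hYs : schattenNorm q Yᴴ = schattenNorm q Y := schattenNorm_star q Y
    have hBs : schattenNorm r B₂ᴴ = schattenNorm r B₂ := schattenNorm_star r B₂
    rw [h2, h3]
    refine (norm_add_le _ _).trans (add_le_add ((norm_add_le _ _).trans (add_le_add ?_ ?_))
      ((norm_add_le _ _).trans (add_le_add ?_ ?_)))
    · exact norm_trace_mul_le hqr _ _
    · rw [← hBs]; exact norm_trace_mul_le hqr _ _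
    · rw [← hYs]; exact norm_trace_mul_le hqr _ _
    · exact norm_trace_mul_le hqr _ _
  set m := herm2 (schattenNorm q X) (schattenNorm q Y : ℝ) (schattenNorm q Z)
  set b := herm2 (schattenNorm r B₁) (schattenNorm r B₂ : ℝ) (schattenNorm r B₃)
  have h4 : schattenNorm q X * schattenNorm r B₁ +
      schattenNorm q Y * schattenNorm r B₂ + (schattenNorm q Y * schattenNorm r B₂ +
      schattenNorm q Z * schattenNorm r B₃) ≤ ‖(m * b).trace‖ := by
    have : (m * b).trace = ((schattenNorm q X * schattenNorm r B₁ +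
      schattenNorm q Y * schattenNorm r B₂ + (schattenNorm q Y * schattenNorm r B₂ +
      schattenNorm q Z * schattenNorm r B₃) : ℝ) : ℂ) := by
      rw [trace_fin_two]
      simp [m, b, herm2, Matrix.mul_apply, Fin.sum_univ_two]
    rw [this, Complex.norm_real]
    exact le_abs_self _
  have h5 : schattenNorm r b ≤ schattenNorm q M ^ (q - 1) := by
    rw [← hB2]
    conv_rhs => rw [hBblock]
    exact schattenNorm_herm2_le hr1 hr2 hBpos
  have h6 : schattenNorm q M ^ q ≤ schattenNorm q m * schattenNorm q M ^ (q - 1) :=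
    h1.trans (h4.trans ((norm_trace_mul_le hqr m b).trans
      (mul_le_mul_of_nonneg_left h5 (schattenNorm_nonneg _ _))))
  rw [← rpow_sub_one_mul_self (by linarith) hpos.le] at h6
  exact le_of_mul_le_mul_right h6 (Real.rpow_pos_of_pos hpos _)

end Hermitian2

/-! ### Complete positivity, two-positivity and reduction to positive matrices -/

section Positivity

variable {ι κ : Type*} [Fintype ι] [DecidableEq ι] [Fintype κ] [DecidableEq κ]

theorem kronecker_induction {P : Mat (ι × κ) → Prop} (h0 : P 0) (hadd : ∀ A B, P A → P B → P (A + B))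
    (hk : ∀ (A : Mat ι) (B : Mat κ), P (A ⊗ₖ B)) (M : Mat (ι × κ)) : P M := by
  obtain ⟨T, rfl⟩ := (kroneckerLinearEquiv ι ι κ κ ℂ).surjective M
  induction T using TensorProduct.induction_on with
  | zero => rwa [map_zero]
  | tmul A B => exact hk A B
  | add A B hA hB => rw [map_add]; exact hadd _ _ hA hB

/-- Entrywise description of the tensor product of two maps. -/
theorem tensorMap_apply (L : SuperOp ι) (K : SuperOp κ) (M : Mat (ι × κ)) (x y : ι) (i j : κ) :
    tensorMap L K M (x, i) (y, j) =
      K (of fun i' j' => L (of fun x' y' => M (x', i') (y', j')) x y) i j := by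
  induction M using kronecker_induction with
  | h0 =>
    have h1 : (of fun x' y' => (0 : Mat (ι × κ)) (x', i) (y', j) : Mat ι) = 0 := rfl
    have h2 : (of fun i' j' => L (of fun x' y' => (0 : Mat (ι × κ)) (x', i') (y', j')) x y) =
        (0 : Mat κ) := by
      ext i' j'
      exact congrFun (congrFun (map_zero L) x) y
    rw [h2, map_zero, map_zero]
    rfl
  | hadd A B hA hB =>
    rw [map_add, Matrix.add_apply, hA, hB, ← Matrix.add_apply, ← map_add]
    refine congrArg (fun N => K N i j) ?_
    ext i' j'
    simp only [Matrix.add_apply, of_apply]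
    rw [← Matrix.add_apply, ← map_add]
    rfl
  | hk A B =>
    rw [tensorMap_kronecker, kroneckerMap_apply, ← smul_eq_mul, ← Matrix.smul_apply, ← map_smul]
    refine congrArg (fun N => K N i j) ?_
    ext i' j'
    have : (of fun x' y' => (A ⊗ₖ B) (x', i') (y', j')) = B i' j' • A := by
      ext x' y'
      simp [mul_comm]
    rw [of_apply, this, map_smul, Matrix.smul_apply, Matrix.smul_apply, smul_eq_mul, smul_eq_mul, mul_comm]

/-- Applying a completely positive map to all blocks of a positive matrix gives a positive matrix,
for any finite index set of blocks. -/
theorem IsCompletelyPositive.posSemidef_blocks {L : SuperOp ι} (hL : IsCompletelyPositive L)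
    {n : Type*} [Finite n] {M : Matrix (n × ι) (n × ι) ℂ} (hM : M.PosSemidef) :
    (of fun x y : n × ι => L (of fun i j => M (x.1, i) (y.1, j)) x.2 y.2).PosSemidef := by
  obtain ⟨m, ⟨e⟩⟩ := Finite.exists_equiv_fin n
  have h := hL m _ (hM.submatrix (Prod.map e.symm id))
  have h2 := h.submatrix (Prod.map e id : n × ι → Fin m × ι)
  convert h2 using 1
  ext x y
  obtain ⟨a, i⟩ := x
  obtain ⟨b, j⟩ := y
  simp only [submatrix_apply, Prod.map_apply, tensorMap_apply, LinearMap.id_apply, of_apply,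
    Equiv.symm_apply_apply, id]

/-- Two-positivity, in terms of `2 × 2` block matrices. -/
def IsTwoPositive (L : SuperOp ι) : Prop :=
  ∀ X Y Z : Mat ι, (fromBlocks X Y Yᴴ Z).PosSemidef →
    (fromBlocks (L X) (L Y) (L Yᴴ) (L Z)).PosSemidef

/-- Every matrix is the off-diagonal block of a positive matrix whose diagonal blocks have the same
norms. -/
theorem exists_posSemidef_fromBlocks (A : Mat ι) :
    ∃ P Q : Mat ι, (fromBlocks P A Aᴴ Q).PosSemidef ∧
      (∀ p, schattenNorm p P = schattenNorm p A) ∧ ∀ p, schattenNorm p Q = schattenNorm p A := by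
  obtain ⟨U, hU, V, hV, d, hd, h⟩ := exists_svd_complex A
  refine ⟨U * diagonal (fun i => (d i : ℂ)) * star U, V * diagonal (fun i => (d i : ℂ)) * star V,
    ?_, fun p => ?_, fun p => ?_⟩
  · have hD : (diagonal (fun i => (d i : ℂ))).PosSemidef :=
      PosSemidef.diagonal fun i => by simpa using hd i
    -- For A = U D V*, stacking U over V and conjugating D produces a positive matrix with
    -- off-diagonal block A.
    have h1 := hD.mul_mul_conjTranspose_same (fromRows U V)
    have h2 : Aᴴ = V * diagonal (fun i => (d i : ℂ)) * star U := by
      rw [h, ← star_eq_conjTranspose, star_mul, star_mul, star_star, star_diagonal_ofReal,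
        Matrix.mul_assoc]
    rw [h2, h]
    rw [conjTranspose_fromRows_eq_fromCols_conjTranspose, fromRows_mul, fromRows_mul_fromCols] at h1
    exact h1
  · rw [schattenNorm_svd p hU hU hd rfl, schattenNorm_svd p hU hV hd h]
  · rw [schattenNorm_svd p hV hV hd rfl, schattenNorm_svd p hU hV hd h]

theorem isTwoPositive_of_fin_two {ι : Type*} {L : SuperOp ι}
    (h : ∀ M : Matrix (Fin 2 × ι) (Fin 2 × ι) ℂ, M.PosSemidef →
      (of fun x y : Fin 2 × ι => L (of fun i j => M (x.1, i) (y.1, j)) x.2 y.2).PosSemidef) :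
    IsTwoPositive L := by
  let f : Fin 2 × ι → ι ⊕ ι := fun x => if x.1 = 0 then Sum.inl x.2 else Sum.inr x.2
  let g : ι ⊕ ι → Fin 2 × ι := Sum.elim (fun i => (0, i)) (fun i => (1, i))
  intro X Y Z hM
  convert (h _ (hM.submatrix f)).submatrix g using 1
  ext x y
  rcases x with x | x <;> rcases y with y | y <;> rfl

theorem IsCompletelyPositive.isTwoPositive {L : SuperOp ι} (hL : IsCompletelyPositive L) :
    IsTwoPositive L :=
  isTwoPositive_of_fin_two fun _ hM => hL.posSemidef_blocks hM

/-- Apply L blockwise with block index `Fin 2 × κ`, then K blockwise with block index `Fin 2 × ι`.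
-/
theorem isTwoPositive_tensorMap {L : SuperOp ι} {K : SuperOp κ} (hL : IsCompletelyPositive L)
    (hK : IsCompletelyPositive K) : IsTwoPositive (tensorMap L K) := by
  refine isTwoPositive_of_fin_two fun M hM => ?_
  have h1 := hL.posSemidef_blocks (n := Fin 2 × κ)
    (hM.submatrix fun x : (Fin 2 × κ) × ι => (x.1.1, (x.2, x.1.2)))
  have h2 := hK.posSemidef_blocks (n := Fin 2 × ι)
    (h1.submatrix fun x : (Fin 2 × ι) × κ => ((x.1.1, x.2), x.1.2))
  convert h2.submatrix (fun x : Fin 2 × (ι × κ) => ((x.1, x.2.1), x.2.2)) using 1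
  ext ⟨a, x, i⟩ ⟨b, y, j⟩
  rw [of_apply, tensorMap_apply]
  rfl

theorem IsTwoPositive.posSemidef {L : SuperOp ι} (hL : IsTwoPositive L) {A : Mat ι}
    (hA : A.PosSemidef) : (L A).PosSemidef := by
  refine posSemidef_block_left (hL A 0 0 ?_)
  have := hA.conjTranspose_mul_mul_same (fromCols (1 : Mat ι) (0 : Mat ι))
  rw [conjTranspose_fromCols_eq_fromRows_conjTranspose, fromRows_mul, fromRows_mul_fromCols] at this
  simpa using this

/-- A and its adjoint are the off-diagonal blocks of a positive matrix, and the image of that matrix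
is Hermitian. -/
theorem IsTwoPositive.map_conjTranspose {L : SuperOp ι} (hL : IsTwoPositive L) (A : Mat ι) :
    L Aᴴ = (L A)ᴴ := by
  obtain ⟨P, Q, hPQ, -, -⟩ := exists_posSemidef_fromBlocks A
  exact ((isHermitian_fromBlocks_iff.1 (hL P A Q hPQ).1).2.1).symm

theorem IsTwoPositive.posSemidef_fromBlocks {L : SuperOp ι} (hL : IsTwoPositive L) {X Y Z : Mat ι}
    (hM : (fromBlocks X Y Yᴴ Z).PosSemidef) :
    (fromBlocks (L X) (L Y) (L Y)ᴴ (L Z)).PosSemidef := by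
  rw [← hL.map_conjTranspose]
  exact hL X Y Z hM

/-- The norm of a two-positive map is attained on positive matrices. -/
theorem IsTwoPositive.schattenNorm_le {L : SuperOp ι} (hL : IsTwoPositive L) {p q : ℝ} (hq : 1 ≤ q)
    {C : ℝ} (hC : 0 ≤ C) (h : ∀ A : Mat ι, A.PosSemidef → schattenNorm q (L A) ≤ C * schattenNorm p A)
    (A : Mat ι) : schattenNorm q (L A) ≤ C * schattenNorm p A := by
  obtain ⟨P, Q, hPQ, hP, hQ⟩ := exists_posSemidef_fromBlocks A
  -- ‖L A‖² ≤ ‖L P‖ ‖L Q‖ ≤ C² ‖P‖ ‖Q‖ = C² ‖A‖².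
  have h1 := schattenNorm_offDiagonal_sq_le hq (hL.posSemidef_fromBlocks hPQ)
  have h2 := h P (posSemidef_block_left hPQ)
  have h3 := h Q (posSemidef_block_right hPQ)
  rw [hP] at h2
  rw [hQ] at h3
  refine (pow_le_pow_iff_left₀ (schattenNorm_nonneg _ _)
    (mul_nonneg hC (schattenNorm_nonneg _ _)) two_ne_zero).1 (h1.trans ?_)
  rw [sq]
  exact mul_le_mul h2 h3 (schattenNorm_nonneg _ _) (mul_nonneg hC (schattenNorm_nonneg _ _))

end Positivity

/-! ### Bloch vectors and the rotated form of a unital qubit channel -/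

section BlochSphere

/-- The traceless Hermitian matrix with Bloch vector `v`. -/
def pauliVec (v : Fin 3 → ℝ) : Mat (Fin 2) := herm2 (v 2) (v 0 - v 1 * Complex.I) (-(v 2))

/-- The Bloch vector of a traceless Hermitian matrix. -/
def blochVec (A : Mat (Fin 2)) : Fin 3 → ℝ := ![(A 0 1).re, -(A 0 1).im, (A 0 0).re]

theorem pauliVec_blochVec {A : Mat (Fin 2)} (hA : A.IsHermitian) (htr : A.trace = 0) :
    pauliVec (blochVec A) = A := by
  have h00 : (A 0 0).im = 0 := by
    have := congrArg Complex.im (hA.apply 0 0)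
    simp only [Complex.star_def, Complex.conj_im] at this
    linarith
  have h10 : A 1 0 = star (A 0 1) := (hA.apply 1 0).symm
  have h11 : A 1 1 = -A 0 0 := by
    rw [trace_fin_two] at htr
    exact eq_neg_of_add_eq_zero_right htr
  ext i j
  fin_cases i <;> fin_cases j <;>
    simp [pauliVec, herm2, blochVec, h10, h11, Complex.ext_iff, h00]

theorem pauliVec_sum {ι : Type*} (s : Finset ι) (c : ι → ℝ) (v : ι → Fin 3 → ℝ) :
    pauliVec (∑ i ∈ s, c i • v i) = ∑ i ∈ s, (c i : ℂ) • pauliVec (v i) := by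
  ext i j
  rw [Matrix.sum_apply]
  fin_cases i <;> fin_cases j <;>
    simp [pauliVec, herm2, Finset.sum_apply, Finset.sum_mul, mul_sub, mul_add,
      Finset.sum_sub_distrib, Finset.sum_add_distrib, mul_assoc]

theorem trace_pauliVec (v : Fin 3 → ℝ) : (pauliVec v).trace = 0 := by
  simp [trace_fin_two, pauliVec, herm2]

theorem trace_pauliVec_mul (v w : Fin 3 → ℝ) :
    (pauliVec v * pauliVec w).trace = ((2 * (v ⬝ᵥ w) : ℝ) : ℂ) := by
  rw [trace_fin_two, Matrix.mul_apply, Matrix.mul_apply, Fin.sum_univ_two, Fin.sum_univ_two]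
  simp [pauliVec, herm2, dotProduct, Fin.sum_univ_three]
  linear_combination (2 * (v 1 : ℂ) * w 1) * -Complex.I_sq

theorem isHermitian_pauliVec (v : Fin 3 → ℝ) : (pauliVec v).IsHermitian := isHermitian_herm2 _ _ _

/-- Unit Bloch vectors in the upper half space can be rotated to the north pole. -/
theorem exists_unitary_conj_pauliVec {v : Fin 3 → ℝ} (hv : v ⬝ᵥ v = 1) (hv2 : 0 ≤ v 2) :
    ∃ V ∈ unitaryGroup (Fin 2) ℂ, V * pauliVec (Pi.single 2 1) * star V = pauliVec v := by
  -- The unitary is the half-turn about the bisector of v and the north pole: W is the Pauli matrix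
  -- of v plus the pole, with W² = 2a. The half space hypothesis keeps a positive.
  set a : ℝ := 1 + v 2 with ha
  have ha0 : 0 < a := by linarith
  set c : ℝ := (√(2 * a))⁻¹ with hc
  have hcc : c * c * (2 * a) = 1 := by
    rw [hc, ← mul_inv, Real.mul_self_sqrt (by positivity), inv_mul_cancel₀ (by positivity)]
  have hcc' : (c : ℂ) * c * (2 * a) = 1 := by exact_mod_cast hcc
  have hn : (v 0 : ℂ) ^ 2 + v 1 ^ 2 + v 2 ^ 2 = 1 := by
    simp only [dotProduct, Fin.sum_univ_three] at hv
    have : v 0 ^ 2 + v 1 ^ 2 + v 2 ^ 2 = 1 := by linarith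
    exact_mod_cast this
  have hac : (a : ℂ) = 1 + v 2 := by rw [ha]; push_cast; rfl
  rw [hac] at hcc'
  have hI := Complex.I_sq
  set W : Mat (Fin 2) := !![(a : ℂ), v 0 - v 1 * Complex.I; v 0 + v 1 * Complex.I, -a] with hW
  have hWs : star W = W := by
    ext i j
    fin_cases i <;> fin_cases j <;> simp [hW, star_apply, ← sub_eq_add_neg]
  refine ⟨(c : ℂ) • W, ?_, ?_⟩
  · rw [mem_unitaryGroup_iff, star_smul, hWs, Complex.star_def, Complex.conj_ofReal,
      smul_mul_smul_comm]
    ext i j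
    fin_cases i <;> fin_cases j <;>
      simp [hW, hac]
    · linear_combination hcc' + c * c * hn - c * c * v 1 ^ 2 * hI
    · ring_nf; simp
    · ring_nf; simp
    · linear_combination hcc' + c * c * hn - c * c * v 1 ^ 2 * hI
  · rw [star_smul, hWs, Complex.star_def, Complex.conj_ofReal, smul_mul_assoc, smul_mul_smul_comm]
    ext i j
    fin_cases i <;> fin_cases j <;>
      simp [hW, hac, pauliVec, herm2, smul_eq_mul]
    · linear_combination v 2 * hcc' - c * c * hn + c * c * v 1 ^ 2 * hI
    · linear_combination (v 0 - v 1 * Complex.I) * hcc'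
    · linear_combination (v 0 + v 1 * Complex.I) * hcc'
    · linear_combination -v 2 * hcc' + c * c * hn - c * c * v 1 ^ 2 * hI

/-- A real `3 × 3` matrix has a pair of singular vectors in the upper half space, for a singular
value which may be negative. -/
theorem exists_singular_pair (T : Matrix (Fin 3) (Fin 3) ℝ) :
    ∃ (v u : Fin 3 → ℝ) (s : ℝ), v ⬝ᵥ v = 1 ∧ 0 ≤ v 2 ∧ u ⬝ᵥ u = 1 ∧ 0 ≤ u 2 ∧
      T *ᵥ v = s • u ∧ u ᵥ* T = s • v := by
  obtain ⟨U, hU, V, hV, d, -, h⟩ := exists_svd T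
  have hU1 := (mem_unitaryGroup_iff').1 hU
  have hV1 := (mem_unitaryGroup_iff').1 hV
  have key : ∃ (v u : Fin 3 → ℝ) (s : ℝ), v ⬝ᵥ v = 1 ∧ u ⬝ᵥ u = 1 ∧
      T *ᵥ v = s • u ∧ u ᵥ* T = s • v := by
    have hTV : T * V = U * diagonal d := by
      rw [h, Matrix.mul_assoc, hV1, Matrix.mul_one]; rfl
    have hUT : star U * T = diagonal d * star V := by
      rw [h, ← Matrix.mul_assoc, ← Matrix.mul_assoc, hU1, Matrix.one_mul]; rfl
    refine ⟨fun i => V i 0, fun i => U i 0, d 0, ?_, ?_, ?_, ?_⟩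
    · simpa [Matrix.mul_apply, star_apply, dotProduct] using congrFun (congrFun hV1 0) 0
    · simpa [Matrix.mul_apply, star_apply, dotProduct] using congrFun (congrFun hU1 0) 0
    · ext i
      have := congrFun (congrFun hTV i) 0
      rw [mul_diagonal, Matrix.mul_apply] at this
      simpa [mulVec, dotProduct, mul_comm] using this
    · ext i
      have := congrFun (congrFun hUT 0) i
      rw [diagonal_mul, Matrix.mul_apply] at this
      simpa [vecMul, dotProduct, star_apply] using this
  obtain ⟨v, u, s, hv, hu, h1, h2⟩ := key
  -- Flipping v together with s preserves both singular vector equations; this is why s may be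
  -- negative.
  obtain ⟨v, s, hv, hv2, h1, h2⟩ : ∃ (v : Fin 3 → ℝ) (s : ℝ), v ⬝ᵥ v = 1 ∧ 0 ≤ v 2 ∧
      T *ᵥ v = s • u ∧ u ᵥ* T = s • v := by
    rcases le_total 0 (v 2) with hv2 | hv2
    · exact ⟨v, s, hv, hv2, h1, h2⟩
    · exact ⟨-v, -s, by simpa using hv, by simpa using hv2, by rw [mulVec_neg, h1, neg_smul],
        by rw [h2, neg_smul_neg]⟩
  rcases le_total 0 (u 2) with hu2 | hu2
  · exact ⟨v, u, s, hv, hv2, hu, hu2, h1, h2⟩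
  · exact ⟨v, -u, -s, hv, hv2, by simpa using hu, by simpa using hu2,
      by rw [h1, neg_smul_neg], by rw [neg_vecMul, h2, neg_smul]⟩

theorem pauliVec_single_two : pauliVec (Pi.single 2 1) = !![(1 : ℂ), 0; 0, -1] := by
  ext i j
  fin_cases i <;> fin_cases j <;> simp [pauliVec, herm2]

theorem single_eq_pauliVec_add :
    (single 0 0 1 : Mat (Fin 2)) = (1 / 2 : ℂ) • (1 + pauliVec (Pi.single 2 1)) ∧
    (single 1 1 1 : Mat (Fin 2)) = (1 / 2 : ℂ) • (1 - pauliVec (Pi.single 2 1)) := by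
  rw [pauliVec_single_two]
  constructor <;> ext i j <;> fin_cases i <;> fin_cases j <;> norm_num [single, Matrix.one_apply]

theorem pauliVec_decomposition (B : Mat (Fin 2)) :
    ∃ (b : ℂ) (c : Fin 3 → ℂ), B = b • 1 + ∑ j, c j • pauliVec (Pi.single j 1) := by
  refine ⟨(B 0 0 + B 1 1) / 2, ![(B 0 1 + B 1 0) / 2, (B 0 1 - B 1 0) * Complex.I / 2,
    (B 0 0 - B 1 1) / 2], ?_⟩
  have hI := Complex.I_sq
  ext i j
  rw [Matrix.add_apply, Matrix.sum_apply, Fin.sum_univ_three]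
  fin_cases i <;> fin_cases j <;>
    simp [pauliVec, herm2]
  · ring
  · linear_combination ((B 0 1 - B 1 0) / 2) * hI
  · linear_combination (-(B 0 1 - B 1 0) / 2) * hI
  · ring

/-- A unital, trace-preserving, positive map of `2 × 2` matrices can be brought by rotations to a form
which does not mix diagonal and off-diagonal entries. -/
theorem exists_rotated_form {Φ : SuperOp (Fin 2)} (hpos : IsPositivityPreserving Φ)
    (hstar : ∀ A, Φ Aᴴ = (Φ A)ᴴ) (htr : ∀ A, (Φ A).trace = A.trace) (hone : Φ 1 = 1) :
    ∃ U ∈ unitaryGroup (Fin 2) ℂ, ∃ V ∈ unitaryGroup (Fin 2) ℂ, ∃ (s : ℝ) (a b : ℂ),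
      -1 ≤ s ∧ s ≤ 1 ∧
      star U * Φ (V * single 0 0 1 * star V) * U = !![((1 + s) / 2 : ℂ), 0; 0, (1 - s) / 2] ∧
      star U * Φ (V * single 0 1 1 * star V) * U = !![0, a; b, 0] ∧
      star U * Φ (V * single 1 0 1 * star V) * U = !![0, star b; star a, 0] ∧
      star U * Φ (V * single 1 1 1 * star V) * U = !![((1 - s) / 2 : ℂ), 0; 0, (1 + s) / 2] := by
  set T : Matrix (Fin 3) (Fin 3) ℝ := of fun i j => blochVec (Φ (pauliVec (Pi.single j 1))) i
    with hT
  have hTe (j : Fin 3) : Φ (pauliVec (Pi.single j 1)) = pauliVec (T.col j) := by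
    refine (pauliVec_blochVec ?_ ?_).symm
    · rw [IsHermitian, ← hstar, (isHermitian_pauliVec _).eq]
    · rw [htr, trace_pauliVec]
  have hTv (v : Fin 3 → ℝ) : Φ (pauliVec v) = pauliVec (T *ᵥ v) := by
    have h1 : v = ∑ j, v j • Pi.single j (1 : ℝ) := by
      ext i; simp [Finset.sum_apply, Pi.single_apply]
    have h2 : T *ᵥ v = ∑ j, v j • T.col j := by
      ext i; simp [mulVec, dotProduct, Finset.sum_apply, mul_comm]
    conv_lhs => rw [h1]
    rw [h2, pauliVec_sum, pauliVec_sum, map_sum]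
    exact Finset.sum_congr rfl fun j _ => by rw [map_smul, hTe]
  obtain ⟨v, u, s, hv, hv2, hu, hu2, hTvu, huT⟩ := exists_singular_pair T
  obtain ⟨V, hV, hVv⟩ := exists_unitary_conj_pauliVec hv hv2
  obtain ⟨U, hU, hUu⟩ := exists_unitary_conj_pauliVec hu hu2
  have hU1 := (mem_unitaryGroup_iff').1 hU
  have hU2 := (mem_unitaryGroup_iff).1 hU
  have hV1 := (mem_unitaryGroup_iff').1 hV
  have hV2 := (mem_unitaryGroup_iff).1 hV
  set Z := pauliVec (Pi.single 2 1) with hZ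
  set Ψ : SuperOp (Fin 2) := LinearMap.mulLeft ℂ (star U) ∘ₗ LinearMap.mulRight ℂ U ∘ₗ Φ ∘ₗ
    LinearMap.mulLeft ℂ V ∘ₗ LinearMap.mulRight ℂ (star V) with hΨdef
  have hΨ (B : Mat (Fin 2)) : Ψ B = star U * Φ (V * B * star V) * U := by
    simp only [hΨdef, LinearMap.comp_apply, LinearMap.mulLeft_apply, LinearMap.mulRight_apply,
      Matrix.mul_assoc]
  have hΨone : Ψ 1 = 1 := by
    rw [hΨ, Matrix.mul_one, hV2, hone, Matrix.mul_one, hU1]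
  have hΨZ : Ψ Z = (s : ℂ) • Z := by
    have h1 : pauliVec (s • u) = (s : ℂ) • pauliVec u := by
      simpa using pauliVec_sum {()} (fun _ => s) (fun _ => u)
    rw [hΨ, hVv, hTv, hTvu, h1, ← hUu, Matrix.mul_smul, Matrix.smul_mul]
    congr 1
    calc _ = (star U * U) * Z * (star U * U) := by simp only [Matrix.mul_assoc]
      _ = Z := by rw [hU1]; simp
  have hΨtr (B : Mat (Fin 2)) : (Ψ B).trace = B.trace := by
    rw [hΨ, trace_mul_cycle, hU2, Matrix.one_mul, htr, trace_unitary_conj hV]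
  have hΨstar (B : Mat (Fin 2)) : Ψ Bᴴ = (Ψ B)ᴴ := by
    rw [hΨ, hΨ]
    simp only [conjTranspose_mul, ← hstar, star_eq_conjTranspose, conjTranspose_conjTranspose,
      Matrix.mul_assoc]
  -- The left singular vector equation in trace form: the adjoint of Φ sends the Pauli matrix of u
  -- to s times that of v. It keeps off-diagonal inputs from producing diagonal outputs.
  have hdual (B : Mat (Fin 2)) : (Φ B * pauliVec u).trace = s * (B * pauliVec v).trace := by
    obtain ⟨b, c, rfl⟩ := pauliVec_decomposition B
    have hj (j : Fin 3) : (Φ (pauliVec (Pi.single j 1)) * pauliVec u).trace =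
        s * (pauliVec (Pi.single j 1) * pauliVec v).trace := by
      have h1 : T.col j ⬝ᵥ u = s * v j := by
        have := congrFun huT j
        rw [Pi.smul_apply, smul_eq_mul] at this
        rw [dotProduct_comm]
        exact this
      rw [hTe, trace_pauliVec_mul, trace_pauliVec_mul, h1, single_one_dotProduct]
      push_cast
      ring
    rw [map_add, map_smul, hone, map_sum]
    simp only [map_smul, Matrix.add_mul, Matrix.smul_mul, Matrix.one_mul, Finset.sum_mul, trace_add,
      trace_smul, trace_sum, trace_pauliVec, hj, smul_eq_mul, mul_zero, zero_add, Finset.mul_sum]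
    exact Finset.sum_congr rfl fun j _ => by ring
  have hΨdual (B : Mat (Fin 2)) : (Ψ B * Z).trace = s * (B * Z).trace := by
    have h1 : (Ψ B * Z).trace = (Φ (V * B * star V) * pauliVec u).trace := by
      rw [hΨ, ← hUu]
      calc _ = (star U * (Φ (V * B * star V) * U * Z)).trace := by simp only [Matrix.mul_assoc]
        _ = _ := by rw [trace_mul_comm]; simp only [Matrix.mul_assoc]
    rw [h1, hdual, ← hVv]
    congr 1
    calc _ = (V * (B * ((star V * V) * Z)) * star V).trace := by simp only [Matrix.mul_assoc]
      _ = _ := by rw [trace_unitary_conj hV, hV1, Matrix.one_mul]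
  have hZe : Z = !![(1 : ℂ), 0; 0, -1] := pauliVec_single_two
  obtain ⟨he0, he1⟩ := single_eq_pauliVec_add
  have h00 : Ψ (single 0 0 1) = !![((1 + s) / 2 : ℂ), 0; 0, (1 - s) / 2] := by
    rw [he0, map_smul, map_add, hΨone, hΨZ, hZe]
    ext i j
    fin_cases i <;> fin_cases j <;> simp <;> ring
  have h11 : Ψ (single 1 1 1) = !![((1 - s) / 2 : ℂ), 0; 0, (1 + s) / 2] := by
    rw [he1, map_smul, map_sub, hΨone, hΨZ, hZe]
    ext i j
    fin_cases i <;> fin_cases j <;> simp <;> ring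
  -- The image has zero trace and zero pairing with Z, so both diagonal entries vanish.
  have h01 : Ψ (single 0 1 1) = !![0, Ψ (single 0 1 1) 0 1; Ψ (single 0 1 1) 1 0, 0] := by
    have h1 := hΨtr (single 0 1 1)
    have h2 := hΨdual (single 0 1 1)
    have h3 : (single 0 1 1 * Z : Mat (Fin 2)).trace = 0 := by
      rw [hZe, trace_fin_two]; simp [Matrix.mul_apply, single]
    have h4 : (single 0 1 1 : Mat (Fin 2)).trace = 0 := by
      rw [trace_fin_two]; simp [single]
    rw [h3, mul_zero, hZe, trace_fin_two, Matrix.mul_apply, Matrix.mul_apply, Fin.sum_univ_two,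
      Fin.sum_univ_two] at h2
    rw [h4, trace_fin_two] at h1
    simp only [of_apply, cons_val', cons_val_zero, cons_val_one, cons_val_fin_one, mul_zero,
      mul_one, mul_neg, add_zero, zero_add] at h2
    have h5 : Ψ (single 0 1 1) 0 0 = 0 := by linear_combination (h1 + h2) / 2
    have h6 : Ψ (single 0 1 1) 1 1 = 0 := by linear_combination (h1 - h2) / 2
    ext i j
    fin_cases i <;> fin_cases j <;> simp [h5, h6]
  have h10 : Ψ (single 1 0 1) = !![0, star (Ψ (single 0 1 1) 1 0); star (Ψ (single 0 1 1) 0 1), 0] := by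
    have h1 : (single 1 0 1 : Mat (Fin 2)) = (single 0 1 1)ᴴ := by
      rw [conjTranspose_single, star_one]
    rw [h1, hΨstar]
    conv_lhs => rw [h01]
    ext i j
    fin_cases i <;> fin_cases j <;> simp
  -- Positivity of this diagonal matrix is what bounds s by 1 in modulus.
  have hE : (Ψ (single 0 0 1)).PosSemidef := by
    rw [hΨ]
    have hs : (single 0 0 1 : Mat (Fin 2)).PosSemidef := by
      have : (single 0 0 1 : Mat (Fin 2)) = herm2 1 0 0 := by
        ext i j
        fin_cases i <;> fin_cases j <;> simp [herm2, single]
      rw [this]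
      exact posSemidef_herm2 zero_le_one le_rfl (by simp)
    exact (hpos _ (hs.mul_mul_conjTranspose_same V)).conjTranspose_mul_mul_same U
  rw [h00] at hE
  have hs0 := (posSemidef_diag_re hE 0).1
  have hs1 := (posSemidef_diag_re hE 1).1
  have hc0 : ((1 + s) / 2 : ℂ) = (((1 + s) / 2 : ℝ) : ℂ) := by push_cast; rfl
  have hc1 : ((1 - s) / 2 : ℂ) = (((1 - s) / 2 : ℝ) : ℂ) := by push_cast; rfl
  simp only [of_apply, cons_val', cons_val_zero, cons_val_one, cons_val_fin_one, hc0, hc1,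
    Complex.ofReal_re] at hs0 hs1
  refine ⟨U, hU, V, hV, s, Ψ (single 0 1 1) 0 1, Ψ (single 0 1 1) 1 0, by linarith, by linarith,
    ?_, ?_, ?_, ?_⟩
  · rw [← hΨ, h00]
  · rw [← hΨ]; exact h01
  · rw [← hΨ]; exact h10
  · rw [← hΨ, h11]

end BlochSphere

/-! ### The upper bound on positive matrices -/

section Multiplicativity

theorem tensorMap_unitary_conj {ι κ : Type*} [Fintype ι] [DecidableEq ι] [Fintype κ]
    [DecidableEq κ] (Ω : SuperOp ι) {Φ Ψ : SuperOp κ} {U V : Mat κ}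
    (hΨ : ∀ B, Ψ B = star U * Φ (V * B * star V) * U) (N : Mat (ι × κ)) :
    tensorMap Ω Ψ N = ((1 : Mat ι) ⊗ₖ star U) *
      tensorMap Ω Φ (((1 : Mat ι) ⊗ₖ V) * N * ((1 : Mat ι) ⊗ₖ star V)) * ((1 : Mat ι) ⊗ₖ U) := by
  induction N using kronecker_induction with
  | h0 => simp
  | hadd A B hA hB =>
    rw [map_add, hA, hB, Matrix.mul_add, Matrix.add_mul, map_add, Matrix.mul_add, Matrix.add_mul]
  | hk A B =>
    rw [← mul_kronecker_mul, ← mul_kronecker_mul, tensorMap_kronecker, tensorMap_kronecker,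
      ← mul_kronecker_mul, ← mul_kronecker_mul, hΨ]
    simp only [Matrix.one_mul, Matrix.mul_one]

/-- The index bijection that displays a matrix on `ι × Fin 2` as a `2 × 2` block matrix. -/
def sumEquivProdFinTwo (ι : Type*) : ι ⊕ ι ≃ ι × Fin 2 where
  toFun := Sum.elim (fun i => (i, 0)) (fun i => (i, 1))
  invFun x := if x.2 = 0 then Sum.inl x.1 else Sum.inr x.1
  left_inv x := by rcases x with x | x <;> simp
  right_inv := by
    rintro ⟨x, i⟩
    fin_cases i <;> simp

theorem superOp_fin_two_apply (Ψ : SuperOp (Fin 2)) (B : Mat (Fin 2)) :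
    Ψ B = B 0 0 • Ψ (single 0 0 1) + B 0 1 • Ψ (single 0 1 1) + B 1 0 • Ψ (single 1 0 1) +
      B 1 1 • Ψ (single 1 1 1) := by
  rw [← map_smul, ← map_smul, ← map_smul, ← map_smul, ← map_add, ← map_add, ← map_add]
  congr 1
  ext i j
  fin_cases i <;> fin_cases j <;> simp [single]

/-- The phase of argument (arg (star b) - arg a) / 2 aligns the two summands. -/
theorem exists_phase (a b : ℂ) :
    ∃ c : ℂ, ‖c‖ = 1 ∧ ‖a * c + star b * star c‖ = ‖a‖ + ‖b‖ := by
  set θ : ℝ := ((star b).arg - a.arg) / 2 with hθ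
  refine ⟨Complex.exp (θ * Complex.I), Complex.norm_exp_ofReal_mul_I θ, ?_⟩
  have h1 : star (Complex.exp (θ * Complex.I)) = Complex.exp (-θ * Complex.I) := by
    rw [Complex.star_def, ← Complex.exp_conj]
    simp
  set φ : ℝ := ((star b).arg + a.arg) / 2 with hφ
  have h2 : a * Complex.exp (θ * Complex.I) + star b * star (Complex.exp (θ * Complex.I)) =
      ((‖a‖ + ‖b‖ : ℝ) : ℂ) * Complex.exp (φ * Complex.I) := by
    have ha := Complex.norm_mul_exp_arg_mul_I a
    have hb := Complex.norm_mul_exp_arg_mul_I (star b)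
    rw [norm_star] at hb
    rw [h1]
    conv_lhs => rw [← ha, ← hb]
    rw [mul_assoc, mul_assoc, ← Complex.exp_add, ← Complex.exp_add]
    have e1 : (a.arg : ℂ) * Complex.I + θ * Complex.I = φ * Complex.I := by
      rw [hθ, hφ]; push_cast; ring
    have e2 : ((star b).arg : ℂ) * Complex.I + -θ * Complex.I = φ * Complex.I := by
      rw [hθ, hφ]; push_cast; ring
    rw [e1, e2]
    push_cast
    ring
  rw [h2, norm_mul, Complex.norm_exp_ofReal_mul_I, mul_one, Complex.norm_real,
    Real.norm_of_nonneg (by positivity)]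

theorem herm2_smul (C x w z : ℝ) :
    herm2 (C * x) ((C * w : ℝ) : ℂ) (C * z) = (C : ℂ) • herm2 x w z := by
  ext i j
  fin_cases i <;> fin_cases j <;> simp [herm2]

variable {k : ℕ} {Ω : SuperOp (Fin k)} {Φ : SuperOp (Fin 2)}

/-- The upper bound of multiplicativity, on positive matrices. -/
theorem schattenNorm_tensorMap_le_of_posSemidef (hΩ : IsCompletelyPositive Ω)
    (hΦ : IsUnitalQubitChannel Φ) {p q : ℝ} (hp1 : 1 ≤ p) (hp2 : p ≤ 2) (hq : 2 ≤ q) {C D : ℝ}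
    (hC : 0 ≤ C) (hD : 0 ≤ D) (hCΩ : ∀ A, schattenNorm q (Ω A) ≤ C * schattenNorm p A)
    (hDΦ : ∀ B, schattenNorm q (Φ B) ≤ D * schattenNorm p B) {M : Mat (Fin k × Fin 2)}
    (hM : M.PosSemidef) :
    schattenNorm q (tensorMap Ω Φ M) ≤ C * D * schattenNorm p M := by
  have hp0 : 0 < p := by linarith
  have hq0 : 0 < q := by linarith
  have hq1 : 1 ≤ q := by linarith
  have hΦ2 := hΦ.isQuantumChannel.completelyPositive.isTwoPositive
  have hΩ2 := hΩ.isTwoPositive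
  have hpos := (isTwoPositive_tensorMap hΩ hΦ.isQuantumChannel.completelyPositive).posSemidef hM
  obtain ⟨U, hU, V, hV, s, a, b, hs0, hs1, h00, h01, h10, h11⟩ :=
    exists_rotated_form (fun A hA => hΦ2.posSemidef hA) hΦ2.map_conjTranspose
      hΦ.isQuantumChannel.trace_map hΦ.map_one
  set Ψ : SuperOp (Fin 2) := LinearMap.mulLeft ℂ (star U) ∘ₗ LinearMap.mulRight ℂ U ∘ₗ Φ ∘ₗ
    LinearMap.mulLeft ℂ V ∘ₗ LinearMap.mulRight ℂ (star V) with hΨdef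
  have hΨ (B : Mat (Fin 2)) : Ψ B = star U * Φ (V * B * star V) * U := by
    simp only [hΨdef, LinearMap.comp_apply, LinearMap.mulLeft_apply, LinearMap.mulRight_apply,
      Matrix.mul_assoc]
  have hΨB (B : Mat (Fin 2)) : Ψ B = !![((1 + s) / 2) * B 0 0 + ((1 - s) / 2) * B 1 1,
      a * B 0 1 + star b * B 1 0; b * B 0 1 + star a * B 1 0,
      ((1 - s) / 2) * B 0 0 + ((1 + s) / 2) * B 1 1] := by
    rw [superOp_fin_two_apply, hΨ, hΨ, hΨ, hΨ, h00, h01, h10, h11]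
    ext i j
    fin_cases i <;> fin_cases j <;> simp <;> ring
  have hone : (1 : Mat (Fin k)) ∈ unitaryGroup (Fin k) ℂ := one_mem _
  have hV1 : ((1 : Mat (Fin k)) ⊗ₖ V) * ((1 : Mat (Fin k)) ⊗ₖ star V) = 1 := by
    rw [← mul_kronecker_mul, (mem_unitaryGroup_iff).1 hV, Matrix.one_mul, one_kronecker_one]
  have hVs : ((1 : Mat (Fin k)) ⊗ₖ V)ᴴ = (1 : Mat (Fin k)) ⊗ₖ star V := by
    rw [conjTranspose_kronecker, conjTranspose_one, star_eq_conjTranspose]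
  set N : Mat (Fin k × Fin 2) := ((1 : Mat (Fin k)) ⊗ₖ star V) * M * ((1 : Mat (Fin k)) ⊗ₖ V)
    with hN
  have hMN : ((1 : Mat (Fin k)) ⊗ₖ V) * N * ((1 : Mat (Fin k)) ⊗ₖ star V) = M := by
    calc _ = (((1 : Mat (Fin k)) ⊗ₖ V) * ((1 : Mat (Fin k)) ⊗ₖ star V)) * M *
          (((1 : Mat (Fin k)) ⊗ₖ V) * ((1 : Mat (Fin k)) ⊗ₖ star V)) := by
          rw [hN]; simp only [Matrix.mul_assoc]
      _ = M := by rw [hV1, Matrix.one_mul, Matrix.mul_one]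
  have hNpos : N.PosSemidef := by
    rw [hN, ← hVs]; exact hM.conjTranspose_mul_mul_same _
  have hNnorm : schattenNorm p N = schattenNorm p M :=
    schattenNorm_unitary_conj p (kronecker_mem_unitary hone (Unitary.star_mem hV))
      (kronecker_mem_unitary hone hV) M
  have hconj := tensorMap_unitary_conj Ω hΨ N
  rw [hMN] at hconj
  have hout : schattenNorm q (tensorMap Ω Ψ N) = schattenNorm q (tensorMap Ω Φ M) := by
    rw [hconj]
    exact schattenNorm_unitary_conj q (kronecker_mem_unitary hone (Unitary.star_mem hU))
      (kronecker_mem_unitary hone hU) _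
  have houtpos : (tensorMap Ω Ψ N).PosSemidef := by
    have hUs : ((1 : Mat (Fin k)) ⊗ₖ star U) = ((1 : Mat (Fin k)) ⊗ₖ U)ᴴ := by
      rw [conjTranspose_kronecker, conjTranspose_one, star_eq_conjTranspose]
    rw [hconj, hUs]
    exact hpos.conjTranspose_mul_mul_same _
  set e := sumEquivProdFinTwo (Fin k)
  set X : Mat (Fin k) := of fun i j => N (i, 0) (j, 0) with hX
  set Y : Mat (Fin k) := of fun i j => N (i, 0) (j, 1) with hY
  set Z : Mat (Fin k) := of fun i j => N (i, 1) (j, 1) with hZ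
  have hYs : Yᴴ = of fun i j => N (i, 1) (j, 0) := by
    ext i j
    exact hNpos.1.apply _ _
  have hNblock : N.submatrix e e = fromBlocks X Y Yᴴ Z := by
    rw [hYs]
    ext i j
    rcases i with i | i <;> rcases j with j | j <;> rfl
  have hNbpos : (fromBlocks X Y Yᴴ Z).PosSemidef := by
    rw [← hNblock]; exact hNpos.submatrix _
  -- In the rotated form, diagonal output blocks involve only Ω X and Ω Z, and off-diagonal ones
  -- only Ω Y and Ω Yᴴ, so each is controlled by the triangle inequality.
  set X' : Mat (Fin k) := ((1 + s) / 2 : ℂ) • Ω X + ((1 - s) / 2 : ℂ) • Ω Z with hX'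
  set Y' : Mat (Fin k) := a • Ω Y + star b • Ω Yᴴ with hY'
  set Z' : Mat (Fin k) := ((1 - s) / 2 : ℂ) • Ω X + ((1 + s) / 2 : ℂ) • Ω Z with hZ'
  have hoblock : (tensorMap Ω Ψ N).submatrix e e = fromBlocks X' Y' Y'ᴴ Z' := by
    have hY's : Y'ᴴ = b • Ω Y + star a • Ω Yᴴ := by
      rw [hY', conjTranspose_add, conjTranspose_smul, conjTranspose_smul, star_star,
        hΩ2.map_conjTranspose, conjTranspose_conjTranspose, add_comm]
    rw [hY's]
    ext i j
    rcases i with i | i <;> rcases j with j | j <;>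
      simp only [submatrix_apply, e, sumEquivProdFinTwo, Equiv.coe_fn_mk, Sum.elim_inl,
        Sum.elim_inr, tensorMap_apply, hΨB, fromBlocks_apply₁₁, fromBlocks_apply₁₂,
        fromBlocks_apply₂₁, fromBlocks_apply₂₂, of_apply, cons_val', cons_val_zero, cons_val_one,
        cons_val_fin_one, hX', hY', hZ', hYs, Matrix.add_apply, Matrix.smul_apply,
        smul_eq_mul] <;> rfl
  have hobpos : (fromBlocks X' Y' Y'ᴴ Z').PosSemidef := by
    rw [← hoblock]; exact houtpos.submatrix _
  have hΩb := hΩ2.posSemidef_fromBlocks hNbpos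
  set x := schattenNorm q (Ω X) with hx
  set y := schattenNorm q (Ω Y) with hy
  set z := schattenNorm q (Ω Z) with hz
  have hn : (herm2 x (y : ℝ) z).PosSemidef := posSemidef_herm2_schattenNorm hq1 hΩb
  have hy0 : 0 ≤ y := schattenNorm_nonneg _ _
  -- With this phase on its off-diagonal entry, the 2 × 2 norm matrix is mapped by Ψ to one with
  -- off-diagonal modulus (‖a‖ + ‖b‖) y, exactly the triangle bound for Y'. The phase does not
  -- change its norm.
  obtain ⟨c, hc, hcab⟩ := exists_phase a b
  have hcy : ‖c * (y : ℂ)‖ = ‖((y : ℝ) : ℂ)‖ := by rw [norm_mul, hc, one_mul]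
  have hnc : (herm2 x (c * y) z).PosSemidef := by
    obtain ⟨h1, h2, h3⟩ := herm2_entries hn
    exact posSemidef_herm2 h1 h2 (hcy ▸ h3)
  have hΨn : Ψ (herm2 x (c * y) z) = herm2 ((1 + s) / 2 * x + (1 - s) / 2 * z)
      ((a * c + star b * star c) * y) ((1 - s) / 2 * x + (1 + s) / 2 * z) := by
    rw [hΨB]
    ext i j
    fin_cases i <;> fin_cases j <;> simp [herm2] <;> ring
  have hΨnpos : (Ψ (herm2 x (c * y) z)).PosSemidef := by
    rw [hΨ]
    exact (hΦ2.posSemidef (hnc.mul_mul_conjTranspose_same V)).conjTranspose_mul_mul_same U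
  rw [hΨn] at hΨnpos
  have hnorm_smul (t : ℝ) (ht : 0 ≤ t) (A : Mat (Fin k)) :
      schattenNorm q ((t : ℂ) • A) = t * schattenNorm q A := by
    rw [schattenNorm_smul hq0, Complex.norm_real, Real.norm_of_nonneg ht]
  have hcp : ((1 + s) / 2 : ℂ) = (((1 + s) / 2 : ℝ) : ℂ) := by push_cast; rfl
  have hcm : ((1 - s) / 2 : ℂ) = (((1 - s) / 2 : ℝ) : ℂ) := by push_cast; rfl
  have hX'le : schattenNorm q X' ≤ (1 + s) / 2 * x + (1 - s) / 2 * z := by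
    rw [hX', hcp, hcm]
    refine (schattenNorm_add_le (by linarith) _ _).trans_eq ?_
    rw [hnorm_smul _ (by linarith), hnorm_smul _ (by linarith)]
  have hZ'le : schattenNorm q Z' ≤ (1 - s) / 2 * x + (1 + s) / 2 * z := by
    rw [hZ', hcp, hcm]
    refine (schattenNorm_add_le (by linarith) _ _).trans_eq ?_
    rw [hnorm_smul _ (by linarith), hnorm_smul _ (by linarith)]
  have hY'le : schattenNorm q Y' ≤ (‖a‖ + ‖b‖) * y := by
    rw [hY']
    refine (schattenNorm_add_le (by linarith) _ _).trans_eq ?_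
    rw [schattenNorm_smul hq0, schattenNorm_smul hq0, norm_star, hΩ2.map_conjTranspose,
      ← star_eq_conjTranspose, schattenNorm_star]
    ring
  have hmp := posSemidef_herm2_schattenNorm hp1 hNbpos
  have hCmp : (herm2 (C * schattenNorm p X) ((C * schattenNorm p Y : ℝ) : ℂ)
      (C * schattenNorm p Z)).PosSemidef := by
    rw [herm2_smul]
    exact hmp.smul (by simpa using hC)
  calc schattenNorm q (tensorMap Ω Φ M)
      = schattenNorm q (fromBlocks X' Y' Y'ᴴ Z') := by
        rw [← hoblock, schattenNorm_submatrix, hout]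
    _ ≤ schattenNorm q (herm2 (schattenNorm q X') (schattenNorm q Y' : ℝ) (schattenNorm q Z')) :=
        schattenNorm_le_herm2 hq hobpos
    _ ≤ schattenNorm q (Ψ (herm2 x (c * y) z)) := by
        rw [hΨn]
        refine schattenNorm_herm2_mono hq1 (posSemidef_herm2_schattenNorm hq1 hobpos) hΨnpos hX'le
          ?_ hZ'le
        rw [norm_mul, hcab, Complex.norm_real, Complex.norm_real, Real.norm_of_nonneg hy0,
          Real.norm_of_nonneg (schattenNorm_nonneg _ _)]
        exact hY'le
    _ = schattenNorm q (Φ (V * herm2 x (c * y) z * star V)) := by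
        rw [hΨ, schattenNorm_unitary_conj q (Unitary.star_mem hU) hU]
    _ ≤ D * schattenNorm p (V * herm2 x (c * y) z * star V) := hDΦ _
    _ = D * schattenNorm p (herm2 x (y : ℝ) z) := by
        rw [schattenNorm_unitary_conj p hV (Unitary.star_mem hV),
          schattenNorm_herm2_congr hp1 hnc hcy]
    _ ≤ D * schattenNorm p (herm2 (C * schattenNorm p X) ((C * schattenNorm p Y : ℝ) : ℂ)
          (C * schattenNorm p Z)) := by
        refine mul_le_mul_of_nonneg_left (schattenNorm_herm2_mono hp1 hn hCmp (hCΩ X) ?_ (hCΩ Z)) hD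
        rw [Complex.norm_real, Complex.norm_real, Real.norm_of_nonneg hy0,
          Real.norm_of_nonneg (mul_nonneg hC (schattenNorm_nonneg _ _))]
        exact hCΩ Y
    _ = D * (C * schattenNorm p (herm2 (schattenNorm p X) (schattenNorm p Y : ℝ)
          (schattenNorm p Z))) := by
        rw [herm2_smul, schattenNorm_smul hp0, Complex.norm_real, Real.norm_of_nonneg hC]
    _ ≤ D * (C * schattenNorm p (fromBlocks X Y Yᴴ Z)) :=
        mul_le_mul_of_nonneg_left (mul_le_mul_of_nonneg_left
          (schattenNorm_herm2_le hp1 hp2 hNbpos) hC) hD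
    _ = C * D * schattenNorm p M := by
        rw [← hNblock, schattenNorm_submatrix, hNnorm]; ring

end Multiplicativity

/-! ### Operator norms in [0, ∞] and the lower bound -/

section MapNorm

variable {ι κ : Type*} [Fintype ι] [DecidableEq ι] [Fintype κ] [DecidableEq κ]

theorem le_mapNorm (p q : ℝ) (L : SuperOp ι) {M : Mat ι} (hM : M ≠ 0) :
    ENNReal.ofReal (schattenNorm q (L M) / schattenNorm p M) ≤ mapNorm p q L :=
  le_iSup₂ (f := fun (M : Mat ι) (_ : M ≠ 0) =>
    ENNReal.ofReal (schattenNorm q (L M) / schattenNorm p M)) M hM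

theorem schattenNorm_le_mapNorm_toReal {p q : ℝ} (hp : 0 < p) (hq : 0 < q) {L : SuperOp ι}
    (hL : mapNorm p q L ≠ ⊤) (M : Mat ι) :
    schattenNorm q (L M) ≤ (mapNorm p q L).toReal * schattenNorm p M := by
  by_cases h0 : M = 0
  · rw [h0, map_zero, schattenNorm_zero hp, schattenNorm_zero hq, mul_zero]
  · rw [← div_le_iff₀ (schattenNorm_pos hp h0)]
    exact (ENNReal.ofReal_le_iff_le_toReal hL).1 (le_mapNorm p q L h0)

theorem mapNorm_le {p q : ℝ} (hp : 0 < p) {L : SuperOp ι} {C : ℝ}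
    (h : ∀ M, schattenNorm q (L M) ≤ C * schattenNorm p M) : mapNorm p q L ≤ ENNReal.ofReal C :=
  iSup₂_le fun M hM => ENNReal.ofReal_le_ofReal ((div_le_iff₀ (schattenNorm_pos hp hM)).2 (h M))

theorem eq_zero_of_mapNorm_eq_zero {p q : ℝ} (hp : 0 < p) (hq : 0 < q) {L : SuperOp ι}
    (hL : mapNorm p q L = 0) : L = 0 := by
  ext1 M
  have h := schattenNorm_le_mapNorm_toReal hp hq (by rw [hL]; exact ENNReal.zero_ne_top) M
  rw [hL, ENNReal.toReal_zero, zero_mul] at h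
  exact schattenNorm_eq_zero hq (le_antisymm h (schattenNorm_nonneg _ _))

theorem mapNorm_zero {p q : ℝ} (hp : 0 < p) (hq : 0 < q) : mapNorm p q (0 : SuperOp ι) = 0 := by
  refine le_antisymm ((mapNorm_le hp (C := 0) fun M => ?_).trans_eq ENNReal.ofReal_zero) zero_le
  rw [LinearMap.zero_apply, schattenNorm_zero hq, zero_mul]

/-- The norm of a tensor product of maps is at least the product of their norms. -/
theorem mapNorm_mul_le (p q : ℝ) (hp : 0 < p) (L : SuperOp ι) (K : SuperOp κ) :
    mapNorm p q L * mapNorm p q K ≤ mapNorm p q (tensorMap L K) := by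
  rw [mapNorm, mapNorm, ENNReal.iSup_mul]
  refine iSup_le fun A => ?_
  rw [ENNReal.iSup_mul]
  refine iSup_le fun hA => ?_
  rw [ENNReal.mul_iSup]
  refine iSup_le fun B => ?_
  rw [ENNReal.mul_iSup]
  refine iSup_le fun hB => ?_
  rw [← ENNReal.ofReal_mul (div_nonneg (schattenNorm_nonneg _ _) (schattenNorm_nonneg _ _)),
    div_mul_div_comm, ← schattenNorm_kronecker, ← schattenNorm_kronecker, ← tensorMap_kronecker]
  refine le_mapNorm p q _ fun h0 => ?_
  have := mul_pos (schattenNorm_pos hp hA) (schattenNorm_pos hp hB)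
  rw [← schattenNorm_kronecker, h0, schattenNorm_zero hp] at this
  exact this.false

end MapNorm

end QubitMult

end

/-! ### Conclusion -/

theorem theorem2 (k : ℕ) (Ω : QubitMult.SuperOp (Fin k)) (Φ : QubitMult.SuperOp (Fin 2))
    (hΩ : QubitMult.IsCompletelyPositive Ω) (hΦ : QubitMult.IsUnitalQubitChannel Φ)
    (p q : ℝ) (hp1 : 1 ≤ p) (hp2 : p ≤ 2) (hq : 2 ≤ q) :
    QubitMult.mapNorm p q (QubitMult.tensorMap Ω Φ) =
      QubitMult.mapNorm p q Ω * QubitMult.mapNorm p q Φ := by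
  have hp0 : 0 < p := by linarith
  have hq0 : 0 < q := by linarith
  refine le_antisymm ?_ (QubitMult.mapNorm_mul_le p q hp0 Ω Φ)
  -- Since 0 · ∞ = 0, vanishing norms are settled first; the norm of Φ cannot vanish because Φ 1 =
  -- 1. An infinite norm then makes the bound trivial, leaving the finite case.
  by_cases hΩ0 : QubitMult.mapNorm p q Ω = 0
  · have h0 : QubitMult.tensorMap Ω Φ = 0 := by
      rw [QubitMult.eq_zero_of_mapNorm_eq_zero hp0 hq0 hΩ0]
      ext1 M
      simp [QubitMult.tensorMap]
    rw [h0, QubitMult.mapNorm_zero hp0 hq0]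
    exact zero_le
  by_cases hΦ0 : QubitMult.mapNorm p q Φ = 0
  · have := QubitMult.eq_zero_of_mapNorm_eq_zero hp0 hq0 hΦ0
    have h1 := hΦ.map_one
    rw [this, LinearMap.zero_apply] at h1
    exact absurd h1 zero_ne_one
  by_cases hΩt : QubitMult.mapNorm p q Ω = ⊤
  · rw [hΩt, ENNReal.top_mul hΦ0]
    exact le_top
  by_cases hΦt : QubitMult.mapNorm p q Φ = ⊤
  · rw [hΦt, ENNReal.mul_top hΩ0]
    exact le_top
  rw [← ENNReal.ofReal_toReal hΩt, ← ENNReal.ofReal_toReal hΦt,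
    ← ENNReal.ofReal_mul ENNReal.toReal_nonneg]
  refine QubitMult.mapNorm_le hp0 ((QubitMult.isTwoPositive_tensorMap hΩ
    hΦ.isQuantumChannel.completelyPositive).schattenNorm_le (by linarith)
    (mul_nonneg ENNReal.toReal_nonneg ENNReal.toReal_nonneg) fun M hM =>
      QubitMult.schattenNorm_tensorMap_le_of_posSemidef hΩ hΦ hp1 hp2 hq ENNReal.toReal_nonneg
        ENNReal.toReal_nonneg (QubitMult.schattenNorm_le_mapNorm_toReal hp0 hq0 hΩt)
        (QubitMult.schattenNorm_le_mapNorm_toReal hp0 hq0 hΦt) hM)
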